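/- Let $a\in\mathbb R$, let $R>0$ satisfy $27R^6>4|a|^3$, let $0<\varepsilon<\sqrt3\,R$, and put $\alpha=e^{2\pi i/3}$. Let $\nu$ be the holomorphic branch, on $\{27|\lambda|^6>4|a|^3\}$, of the solution of $\nu(\lambda)^3-a\,\nu(\lambda)=\lambda^3$ with $\nu(\lambda)-\lambda\to0$ as $\lambda\to\infty$; explicitly $\nu(\lambda)=\lambda c(\lambda)+\frac{a}{3\lambda c(\lambda)}$ with $$c(\lambda)=\Bigl(\tfrac12\Bigl(1+\sqrt{1-\tfrac{4a^3}{27\lambda^6}}\Bigr)\Bigr)^{1/3}\quad\text{(principal branches)}.$$ Let $D=\{|\lambda|>R,\ -\tfrac{2\pi}3<\arg\lambda<-\tfrac\pi3\}$ and $E=\{\lambda:-\lambda\in D\}$. The following contours are all oriented from left to right. * $\Gamma_+$ is the real line with $(-R,R)$ replaced by the semicircle of radius $R$ about $0$ in the lower half-plane. * $\partial D$ comes in along the ray $\{\alpha^2 s:s\ge R\}$, follows the arc $Re^{i\mu}$, $-\tfrac{2\pi}3\le\mu\le-\tfrac\pi3$, and goes out along $\{-\alpha s:s\ge R\}$. *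 $\Gamma$ comes in along $\{\alpha^2(s-i\varepsilon):s\ge R\}$, then follows the segment from $\alpha^2(R-i\varepsilon)$ to $\alpha^2R$, the same arc, and the segment from $-\alpha R$ to $\alpha(-R-i\varepsilon)$, and goes out along $\{\alpha(-s-i\varepsilon):s\ge R\}$. For $C\ge R$ let $\partial D_C$ and $\Gamma_C$ be the parts of $\partial D$ and $\Gamma$ obtained by restricting the parameter $s$ on the rays to $[R,C]$. Suppose that $\theta\in L^1\cap L^\infty(\Gamma_+)$ extends to $\Omega=\{\operatorname{Im}\lambda\le0,\ |\lambda|\ge R\}$ and that $\theta=\phi+\psi$ on $\Omega$, where $\phi$ and $\psi$ are continuous on $\Omega$ and holomorphic in its interior. Suppose also that, as $\lambda\to\infty$ within $\operatorname{clos}(\alpha E)\cup\operatorname{clos}(\alpha^2E)$, $\psi(\lambda)=O(\lambda^{-4})$ and $\phi(\lambda)\to0$, both uniformly in $\arg\lambda$. Then for every $k\in\{0,1,2\}$ and every $t>0$ the function $$I_t(x)=\int_{\Gamma_+}e^{i\nu(\lambda)x-i\lambda^3t}\,\theta(\lambda)\,d\lambda$$ is $k$ times continuously differentiable on $(0,\infty)$,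 both of the following limits exist, and they are equal: $$(-i)^k\lim_{x\to0^+}\partial_x^k I_t(x)=\lim_{C\to\infty}\left[\int_{\partial D_C}e^{-i\lambda^3t}\,\psi(\lambda)\,\nu(\lambda)^k\,d\lambda+\int_{\Gamma_C}e^{-i\lambda^3t}\,\phi(\lambda)\,\nu(\lambda)^k\,d\lambda\right].$$ -/

import Mathlib

open Filter Topology MeasureTheory
open scoped Pointwise

noncomputable section

namespace VertexRewriting

/-- The primitive cube root of unity `α = exp (2πi/3)`. -/
def alpha : ℂ := Complex.exp (2 * Real.pi * Complex.I / 3)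

/-- Principal branch of `((1 + √(1 - 4a³/(27z⁶)))/2)^(1/3)`; it is holomorphic for
`27 |z|⁶ > 4 |a|³` and tends to `1` at infinity. -/
def nuFactor (a : ℝ) (z : ℂ) : ℂ :=
  ((1 + (1 - 4 * (a : ℂ) ^ 3 / (27 * z ^ 6)) ^ (1 / 2 : ℂ)) / 2) ^ (1 / 3 : ℂ)

/-- The branch `ν` of the solution of `ν³ - aν = z³` with `ν(z) = z + O(1/z)` at infinity,
in closed form (Cardano). See `nu_cubic`, `differentiableAt_nu`, `tendsto_nu_sub`. -/
def nu (a : ℝ) (z : ℂ) : ℂ :=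
  z * nuFactor a z + a / (3 * (z * nuFactor a z))

/-- The sector `D = {z : |z| > R, -2π/3 < arg z < -π/3}`. -/
def sectorD (R : ℝ) : Set ℂ :=
  {z | R < ‖z‖ ∧ -(2 * Real.pi / 3) < z.arg ∧ z.arg < -(Real.pi / 3)}

/-- `E = {z : -z ∈ D}`. -/
def sectorE (R : ℝ) : Set ℂ := {z | -z ∈ sectorD R}

/-- The closed set `clos (αE) ∪ clos (α²E)`. -/
def closedSectors (R : ℝ) : Set ℂ :=
  closure (alpha • sectorE R) ∪ closure (alpha ^ 2 • sectorE R)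

/-- The closed lower half plane with the open disc of radius `R` removed. -/
def lowerExterior (R : ℝ) : Set ℂ := {z | z.im ≤ 0 ∧ R ≤ ‖z‖}

/-- `∫ f(z) dz` along `s ↦ p + s v`, with `s` going from `s₁` to `s₂`. -/
def lineIntegral (p v : ℂ) (s₁ s₂ : ℝ) (f : ℂ → ℂ) : ℂ :=
  ∫ s in s₁..s₂, f (p + s * v) * v

/-- The point `R exp (iμ)`. -/
def arcPoint (R μ : ℝ) : ℂ := R * Complex.exp (μ * Complex.I)

/-- `∫ f(z) dz` along `μ ↦ R exp (iμ)`, with `μ` going from `μ₁` to `μ₂`. -/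
def arcIntegral (R μ₁ μ₂ : ℝ) (f : ℂ → ℂ) : ℂ :=
  ∫ μ in μ₁..μ₂, f (arcPoint R μ) * (Complex.I * arcPoint R μ)

/-- `∫ f(z) dz` along `Γ₊`: the real line from `-∞` to `∞`, with `(-R, R)` replaced by the
semicircle of radius `R` about `0` in the lower half plane. -/
def gammaPlusIntegral (R : ℝ) (f : ℂ → ℂ) : ℂ :=
  (∫ s in Set.Iic (-R), f (s : ℂ)) + arcIntegral R (-Real.pi) 0 f
    + ∫ s in Set.Ici R, f (s : ℂ)

/-- `f ∈ L^p(Γ₊)` with respect to arc length (a constant multiple of `dμ` on the semicircle). -/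
def MemLpGammaPlus (R : ℝ) (p : ENNReal) (f : ℂ → ℂ) : Prop :=
  MemLp (fun s : ℝ => f (s : ℂ)) p (volume.restrict (Set.Iic (-R) ∪ Set.Ici R)) ∧
    MemLp (fun μ : ℝ => f (arcPoint R μ)) p (volume.restrict (Set.Icc (-Real.pi) 0))

/-- `∫ f(z) dz` along the part `|z| < C` of `∂D`: inwards along the ray `arg z = -2π/3`, along the
arc of radius `R` to `arg z = -π/3`, and outwards along that ray. -/
def boundaryDIntegral (R C : ℝ) (f : ℂ → ℂ) : ℂ :=
  lineIntegral 0 (alpha ^ 2) C R f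
    + arcIntegral R (-(2 * Real.pi / 3)) (-(Real.pi / 3)) f
    + lineIntegral 0 (-alpha) R C f

/-- `∫ f(z) dz` along the truncation `Γ_C` of `Γ`, from left to right. The contour `Γ` is `∂D` with
its two rays shifted by `ε` away from `D`: the points `α²(s - iε)` with `s` from `C` to `R`, the
segment from `α²(R - iε)` to `α²R`, the arc of `∂D`, the segment from `-αR` to `α(-R - iε)`, and
the points `α(-s - iε)` with `s` from `R` to `C`. -/
def gammaIntegral (R ε C : ℝ) (f : ℂ → ℂ) : ℂ :=
  lineIntegral (-(alpha ^ 2 * Complex.I * ε)) (alpha ^ 2) C R f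
    + lineIntegral (alpha ^ 2 * R) (-(alpha ^ 2 * Complex.I)) ε 0 f
    + arcIntegral R (-(2 * Real.pi / 3)) (-(Real.pi / 3)) f
    + lineIntegral (-(alpha * R)) (-(alpha * Complex.I)) 0 ε f
    + lineIntegral (-(alpha * Complex.I * ε)) (-alpha) R C f

lemma norm_nu_arg_lt {a : ℝ} {z : ℂ} (hz : 4 * |a| ^ 3 < 27 * ‖z‖ ^ 6) :
    ‖4 * (a : ℂ) ^ 3 / (27 * z ^ 6)‖ < 1 := by
  have h0 : 0 < 27 * ‖z‖ ^ 6 := lt_of_le_of_lt (by positivity) hz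
  simp only [norm_div, norm_mul, norm_pow, Complex.norm_real, Real.norm_eq_abs,
    RCLike.norm_ofNat]
  rwa [div_lt_one h0]

lemma one_sub_mem_slitPlane {w : ℂ} (hw : ‖w‖ < 1) : 1 - w ∈ Complex.slitPlane := by
  left
  have := (Complex.re_le_norm w).trans_lt hw
  simp only [Complex.sub_re, Complex.one_re]
  linarith

lemma re_sqrt_nonneg (w : ℂ) : 0 ≤ (w ^ (1 / 2 : ℂ)).re := by
  by_cases h : w = 0
  · simp [h]
  rw [Complex.cpow_def_of_ne_zero h, Complex.exp_re]
  apply mul_nonneg (Real.exp_pos _).le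
  apply Real.cos_nonneg_of_mem_Icc
  have him : (Complex.log w * (1 / 2 : ℂ)).im = w.arg / 2 := by
    simp [Complex.mul_im, Complex.log_im, div_eq_mul_inv]
  rw [him]
  constructor <;> linarith [Complex.neg_pi_lt_arg w, Complex.arg_le_pi w]

lemma half_one_add_sqrt_mem_slitPlane (w : ℂ) :
    (1 + w ^ (1 / 2 : ℂ)) / 2 ∈ Complex.slitPlane := by
  left
  have := re_sqrt_nonneg w
  have h : ((1 + w ^ (1 / 2 : ℂ)) / 2).re = (1 + (w ^ (1 / 2 : ℂ)).re) / 2 := by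
    simp
  rw [h]
  linarith

lemma nuFactor_ne_zero (a : ℝ) (z : ℂ) : nuFactor a z ≠ 0 := by
  have h := Complex.slitPlane_ne_zero
    (half_one_add_sqrt_mem_slitPlane (1 - 4 * (a : ℂ) ^ 3 / (27 * z ^ 6)))
  simp only [nuFactor, ne_eq, Complex.cpow_eq_zero_iff, not_and_or]
  exact Or.inl h

lemma ne_zero_of_lt {a : ℝ} {z : ℂ} (hz : 4 * |a| ^ 3 < 27 * ‖z‖ ^ 6) : z ≠ 0 := by
  rintro rfl
  have : 0 ≤ 4 * |a| ^ 3 := by positivity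
  simp at hz
  linarith

/-- `ν³ - aν = z³`. -/
lemma nu_cubic {a : ℝ} {z : ℂ} (hz : 4 * |a| ^ 3 < 27 * ‖z‖ ^ 6) :
    nu a z ^ 3 - a * nu a z = z ^ 3 := by
  have hz0 := ne_zero_of_lt hz
  have hc := nuFactor_ne_zero a z
  set q : ℂ := (1 - 4 * (a : ℂ) ^ 3 / (27 * z ^ 6)) ^ (1 / 2 : ℂ) with hq
  have hq2 : q ^ 2 = 1 - 4 * (a : ℂ) ^ 3 / (27 * z ^ 6) := by
    simp [hq]
  have hc3 : nuFactor a z ^ 3 = (1 + q) / 2 := by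
    simp [nuFactor, hq]
  have h6 : 27 * z ^ 6 * (nuFactor a z ^ 3) ^ 2 - 27 * z ^ 6 * nuFactor a z ^ 3
      + (a : ℂ) ^ 3 = 0 := by
    rw [hc3]
    field_simp at hq2
    linear_combination (1 / 4 : ℂ) * hq2
  simp only [nu]
  generalize nuFactor a z = c at *
  field_simp
  linear_combination h6

/-- `ν` is holomorphic where `27 |z|⁶ > 4 |a|³`. -/
lemma differentiableAt_nu {a : ℝ} {z : ℂ} (hz : 4 * |a| ^ 3 < 27 * ‖z‖ ^ 6) :
    DifferentiableAt ℂ (nu a) z := by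
  have hz0 := ne_zero_of_lt hz
  have h6 : (27 * z ^ 6 : ℂ) ≠ 0 := mul_ne_zero (by norm_num) (pow_ne_zero _ hz0)
  have h1 : DifferentiableAt ℂ (nuFactor a) z := by
    have hin : DifferentiableAt ℂ (fun z : ℂ => 1 - 4 * (a : ℂ) ^ 3 / (27 * z ^ 6)) z := by
      fun_prop (disch := assumption)
    have hs := hin.cpow_const (c := (1 / 2 : ℂ)) (one_sub_mem_slitPlane (norm_nu_arg_lt hz))
    exact ((hs.const_add 1).div_const 2).cpow_const (half_one_add_sqrt_mem_slitPlane _)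
  have h3 : 3 * (z * nuFactor a z) ≠ 0 :=
    mul_ne_zero (by norm_num) (mul_ne_zero hz0 (nuFactor_ne_zero a z))
  unfold nu
  fun_prop (disch := assumption)

/-- `ν(z) - z → 0` at infinity. -/
lemma tendsto_nu_sub (a : ℝ) :
    Tendsto (fun z => nu a z - z) (Bornology.cobounded ℂ) (𝓝 0) := by
  set g : ℂ → ℂ := fun w => ((1 + (1 - w) ^ (1 / 2 : ℂ)) / 2) ^ (1 / 3 : ℂ) with hg
  have hgd : DifferentiableAt ℂ g 0 := by
    have hin : DifferentiableAt ℂ (fun w : ℂ => 1 - w) 0 := by fun_prop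
    have hs := hin.cpow_const (c := (1 / 2 : ℂ)) (one_sub_mem_slitPlane (by simp))
    exact ((hs.const_add 1).div_const 2).cpow_const (half_one_add_sqrt_mem_slitPlane _)
  have hg0 : g 0 = 1 := by
    norm_num [hg]
  have hinv : Tendsto (fun z : ℂ => z⁻¹) (Bornology.cobounded ℂ) (𝓝 0) :=
    tendsto_inv₀_cobounded
  have hw : Tendsto (fun z : ℂ => 4 * (a : ℂ) ^ 3 / (27 * z ^ 6)) (Bornology.cobounded ℂ)
      (𝓝 0) := by
    have h := (hinv.pow 6).const_mul (4 * (a : ℂ) ^ 3 / 27)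
    simp only [ne_eq, OfNat.ofNat_ne_zero, not_false_eq_true, zero_pow, mul_zero] at h
    refine h.congr fun z => ?_
    rw [inv_pow, div_mul_eq_div_div, div_eq_mul_inv _ (z ^ 6)]
  have hc : Tendsto (nuFactor a) (Bornology.cobounded ℂ) (𝓝 1) := by
    have h := hgd.continuousAt.tendsto.comp hw
    rwa [hg0] at h
  have hO : (fun z => nuFactor a z - 1) =O[Bornology.cobounded ℂ]
      fun z : ℂ => 4 * (a : ℂ) ^ 3 / (27 * z ^ 6) := by
    have h := hgd.isBigO_sub.comp_tendsto hw
    rw [hg0] at h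
    simp only [sub_zero] at h
    exact h
  have hO' : (fun z => z * (nuFactor a z - 1)) =O[Bornology.cobounded ℂ]
      fun z : ℂ => z * (4 * (a : ℂ) ^ 3 / (27 * z ^ 6)) :=
    (Asymptotics.isBigO_refl _ _).mul hO
  have hne : ∀ᶠ z : ℂ in Bornology.cobounded ℂ, z ≠ 0 := by
    filter_upwards [(tendsto_norm_cobounded_atTop (E := ℂ)).eventually_gt_atTop 0] with z hz
    exact norm_pos_iff.mp hz
  have h1 : Tendsto (fun z => z * (nuFactor a z - 1)) (Bornology.cobounded ℂ) (𝓝 0) := by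
    refine hO'.trans_tendsto ?_
    have h := (hinv.pow 5).const_mul (4 * (a : ℂ) ^ 3 / 27)
    simp only [ne_eq, OfNat.ofNat_ne_zero, not_false_eq_true, zero_pow, mul_zero] at h
    refine h.congr' ?_
    filter_upwards [hne] with z hz
    field_simp
  have h2 : Tendsto (fun z => a / 3 * (z⁻¹ * (nuFactor a z)⁻¹)) (Bornology.cobounded ℂ)
      (𝓝 0) := by
    have h := (hinv.mul (hc.inv₀ one_ne_zero)).const_mul ((a : ℂ) / 3)
    simpa using h
  have h := h1.add h2
  rw [add_zero] at h
  refine h.congr fun z => ?_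
  rw [nu, div_mul_eq_div_div, div_eq_mul_inv _ (z * nuFactor a z), mul_inv]
  ring

end VertexRewriting

end

/-! The difficulty is that on `Γ₊` and on `∂D` the factor `exp(-iλ³t)` has modulus at most 1 but
need not decay along the rays, so neither differentiation in `x` nor the limit `x → 0` can be taken
under the integral. On `Γ` both are harmless. With `λ = -αw` or `λ = α²w`, `α³ = 1` gives `λ³ =
∓w³`, and for `w = s ± iε` the modulus of `exp(-iλ³t)` is `exp(t(ε³ - 3εs²))`. This Gaussian decay
absorbs `exp(A|ν|)` for every `A`, because `ν(λ) - λ` is bounded.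

The proof therefore moves `Γ₊` to `Γ` (`gammaPlusIntegral_kernel`), for every real `x`. The sectors
`-π/3 ≤ arg λ ≤ 0` and `-π ≤ arg λ ≤ -2π/3` are swept out, where `exp(-iλ³t)` is bounded. For `x >
0` the factor `exp(iνx)` grows in the lower half plane, and near the edges of the sectors the cubic
exponential does not compensate for it. The integrand is therefore multiplied by `exp(-ηcλ²)`, where
`c = exp(±iπ/3)` makes `Re(cλ²) ≥ |λ|²/2` on the sector. For `η > 0` everything at infinity
vanishes, and `η → 0` follows by dominated convergence (`arcIntegral_add_rayIntInfty`).

The integral over `Γ` is smooth on all of `ℝ`, so its derivative at `x → 0⁺` is the value at `x =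
0`, with weight `(iν)^k`. Finally `θ = φ + ψ` is split along `Γ_C`. The `ψ` part returns to `∂D_C`:
the error consists of two segments of length `ε` at distance `C`, which vanish since `λψν^k =
O(1/λ)` for `k ≤ 2` (`tendsto_boundaryDIntegral_sub`). -/

noncomputable section

namespace VertexRewriting

/-! ### Cauchy's theorem on annular sectors and strips -/

/-- `∫ f(z) dz` along the truncated ray `s ↦ v (s + iδ)`, `s` from `R` to `C`. -/
def rayInt (v : ℂ) (δ R C : ℝ) (f : ℂ → ℂ) : ℂ :=
  ∫ s in R..C, f (v * (s + δ * Complex.I)) * v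

/-- `∫ f(z) dz` along the infinite ray `s ↦ v (s + iδ)`, `s ≥ R`. -/
def rayIntInfty (v : ℂ) (δ R : ℝ) (f : ℂ → ℂ) : ℂ :=
  ∫ s in Set.Ioi R, f (v * (s + δ * Complex.I)) * v

/-- `∫ f(z) dz` along the segment `y ↦ v (s + iy)`, `y` from `0` to `δ`. -/
def segInt (v : ℂ) (δ s : ℝ) (f : ℂ → ℂ) : ℂ :=
  ∫ y in (0 : ℝ)..δ, f (v * (s + y * Complex.I)) * (Complex.I * v)

lemma norm_arcPoint {R : ℝ} (hR : 0 ≤ R) (μ : ℝ) : ‖arcPoint R μ‖ = R := by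
  simp [arcPoint, Complex.norm_exp_ofReal_mul_I, abs_of_nonneg hR]

@[fun_prop]
lemma continuous_arcPoint (R : ℝ) : Continuous (arcPoint R) := by
  unfold arcPoint; fun_prop

lemma exp_log_add_mul_I {r : ℝ} (hr : 0 < r) (μ : ℝ) :
    Complex.exp ((Real.log r : ℂ) + μ * Complex.I) = arcPoint r μ := by
  rw [Complex.exp_add, ← Complex.ofReal_exp, Real.exp_log hr, arcPoint]

/-- Cauchy's theorem for an annular sector. -/
lemma arcIntegral_add_rayInt {f : ℂ → ℂ} {R C μ₀ μ₁ : ℝ} (hR : 0 < R) (hRC : R ≤ C)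
    {S : Set ℂ} (hS : ∀ r ∈ Set.Icc R C, ∀ μ ∈ Set.uIcc μ₀ μ₁, arcPoint r μ ∈ S)
    (hf : ContinuousOn f S)
    (hd : ∀ r > R, ∀ μ ∈ Set.Ioo (min μ₀ μ₁) (max μ₀ μ₁),
      DifferentiableAt ℂ f (arcPoint r μ)) :
    arcIntegral R μ₀ μ₁ f + rayInt (Complex.exp (μ₁ * Complex.I)) 0 R C f =
      arcIntegral C μ₀ μ₁ f + rayInt (Complex.exp (μ₀ * Complex.I)) 0 R C f := by
  have hC : 0 < C := hR.trans_le hRC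
  have hlog : Real.log R ≤ Real.log C := Real.log_le_log hR hRC
  have hexp : ∀ w : ℂ, Complex.exp w = arcPoint (Real.exp w.re) w.im := by
    intro w
    rw [arcPoint, Complex.ofReal_exp, ← Complex.exp_add, Complex.re_add_im]
  -- The substitution `z = exp w` turns the annular sector into the rectangle `[log R, log C] × [μ₀,
  -- μ₁]`.
  have key := Complex.integral_boundary_rect_eq_zero_of_continuousOn_of_differentiableOn
    (fun w => f (Complex.exp w) * Complex.exp w) (Real.log R + μ₀ * Complex.I)
    (Real.log C + μ₁ * Complex.I) ?_ ?_
  · have hray : ∀ μ : ℝ, (∫ x in Real.log R..Real.log C,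
        f (Complex.exp (x + μ * Complex.I)) * Complex.exp (x + μ * Complex.I)) =
        rayInt (Complex.exp (μ * Complex.I)) 0 R C f := by
      intro μ
      have h := intervalIntegral.integral_deriv_smul_comp_of_deriv_nonneg
        (a := Real.log R) (b := Real.log C) (f := Real.exp) (f' := Real.exp)
        (g := fun s : ℝ => f (Complex.exp (μ * Complex.I) * (s + (0 : ℝ) * Complex.I)) *
          Complex.exp (μ * Complex.I)) Real.continuous_exp.continuousOn
        (fun x _ => Real.hasDerivAt_exp x) (fun x _ => (Real.exp_pos x).le)
      rw [Real.exp_log hR, Real.exp_log hC] at h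
      rw [rayInt, ← h]
      refine intervalIntegral.integral_congr fun x _ => ?_
      simp only [Function.comp_apply, Complex.real_smul, Complex.exp_add, Complex.ofReal_exp,
        Complex.ofReal_zero, zero_mul, add_zero]
      rw [mul_comm (Complex.exp (μ * Complex.I)) (Complex.exp x)]
      ring
    have harc : ∀ r : ℝ, 0 < r → Complex.I • (∫ y in μ₀..μ₁,
        f (Complex.exp (Real.log r + y * Complex.I)) * Complex.exp (Real.log r + y * Complex.I)) =
        arcIntegral r μ₀ μ₁ f := by
      intro r hr
      rw [arcIntegral, ← intervalIntegral.integral_smul]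
      refine intervalIntegral.integral_congr fun y _ => ?_
      simp only [exp_log_add_mul_I hr, smul_eq_mul]
      ring
    simp only [Complex.add_re, Complex.ofReal_re, Complex.mul_re, Complex.I_re, mul_zero,
      Complex.ofReal_im, Complex.I_im, mul_one, sub_self, add_zero, Complex.add_im,
      Complex.mul_im, zero_add, hray, harc R hR, harc C hC] at key
    linear_combination -key
  · have hmaps : Set.MapsTo Complex.exp
        (Set.uIcc (Real.log R) (Real.log C) ×ℂ Set.uIcc μ₀ μ₁) S := by
      intro w hw
      rw [Complex.mem_reProdIm, Set.uIcc_of_le hlog] at hw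
      rw [hexp]
      refine hS _ ⟨?_, ?_⟩ _ hw.2
      · rw [← Real.log_le_iff_le_exp hR]; exact hw.1.1
      · rw [← Real.le_log_iff_exp_le hC]; exact hw.1.2
    simp only [Complex.add_re, Complex.ofReal_re, Complex.mul_re, Complex.I_re, mul_zero,
      Complex.ofReal_im, Complex.I_im, mul_one, sub_self, add_zero, Complex.add_im,
      Complex.mul_im, zero_add]
    exact (hf.comp Complex.continuous_exp.continuousOn hmaps).mul
      Complex.continuous_exp.continuousOn
  · intro w hw
    simp only [Complex.mem_reProdIm, Complex.add_re, Complex.ofReal_re, Complex.mul_re,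
      Complex.I_re, mul_zero,
      Complex.ofReal_im, Complex.I_im, mul_one, sub_self, add_zero, Complex.add_im,
      Complex.mul_im, zero_add, min_eq_left hlog, max_eq_right hlog] at hw
    have h1 : DifferentiableAt ℂ f (Complex.exp w) := by
      rw [hexp]
      exact hd _ ((Real.log_lt_iff_lt_exp hR).1 hw.1.1) _ hw.2
    exact ((h1.comp w Complex.differentiable_exp.differentiableAt).mul
      Complex.differentiable_exp.differentiableAt).differentiableWithinAt

/-- Cauchy's theorem for a rotated rectangle. -/
lemma rayInt_add_segInt {f : ℂ → ℂ} {v : ℂ} {R C δ : ℝ} (hRC : R ≤ C) {S : Set ℂ}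
    (hS : ∀ s ∈ Set.Icc R C, ∀ y ∈ Set.uIcc 0 δ, v * (s + y * Complex.I) ∈ S)
    (hf : ContinuousOn f S)
    (hd : ∀ s > R, ∀ y ∈ Set.Ioo (min 0 δ) (max 0 δ),
      DifferentiableAt ℂ f (v * (s + y * Complex.I))) :
    rayInt v 0 R C f + segInt v δ C f = segInt v δ R f + rayInt v δ R C f := by
  have key := Complex.integral_boundary_rect_eq_zero_of_continuousOn_of_differentiableOn
    (fun w => f (v * w) * v) R (C + δ * Complex.I) ?_ ?_
  · have hseg : ∀ s : ℝ, Complex.I • (∫ y in (0 : ℝ)..δ, f (v * (s + y * Complex.I)) * v) =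
        segInt v δ s f := by
      intro s
      rw [segInt, ← intervalIntegral.integral_smul]
      refine intervalIntegral.integral_congr fun y _ => ?_
      simp only [smul_eq_mul]
      ring
    simp only [Complex.add_re, Complex.ofReal_re, Complex.mul_re, Complex.I_re, mul_zero,
      Complex.ofReal_im, Complex.I_im, mul_one, sub_self, add_zero, Complex.add_im,
      Complex.mul_im, zero_add, hseg] at key
    simp only [rayInt]
    linear_combination key
  · simp only [Complex.add_re, Complex.ofReal_re, Complex.mul_re, Complex.I_re, mul_zero,
      Complex.ofReal_im, Complex.I_im, mul_one, sub_self, add_zero, Complex.add_im,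
      Complex.mul_im, zero_add]
    refine (hf.comp (by fun_prop) fun w hw => ?_).mul continuousOn_const
    rw [Complex.mem_reProdIm, Set.uIcc_of_le hRC] at hw
    have := hS _ hw.1 _ hw.2
    rwa [Complex.re_add_im] at this
  · simp only [Complex.add_re, Complex.ofReal_re, Complex.mul_re, Complex.I_re, mul_zero,
      Complex.ofReal_im, Complex.I_im, mul_one, sub_self, add_zero, Complex.add_im,
      Complex.mul_im, zero_add, min_eq_left hRC, max_eq_right hRC]
    intro w hw
    rw [Complex.mem_reProdIm] at hw
    have := hd _ hw.1.1 _ hw.2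
    rw [Complex.re_add_im] at this
    have h2 : DifferentiableAt ℂ (fun w : ℂ => v * w) w := by fun_prop
    exact ((this.comp w h2).mul_const v).differentiableWithinAt

/-! ### Vanishing of far arcs and segments -/

/-- Arcs of radius `C` do not contribute in the limit if `z f(z) → 0`. -/
lemma tendsto_arcIntegral {f : ℂ → ℂ} {S : Set ℂ} {R μ₀ μ₁ : ℝ}
    (hS : ∀ r ≥ R, ∀ μ ∈ Set.uIcc μ₀ μ₁, arcPoint r μ ∈ S)
    (hf : Tendsto (fun z => z * f z) (Bornology.cobounded ℂ ⊓ 𝓟 S) (𝓝 0)) :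
    Tendsto (fun C => arcIntegral C μ₀ μ₁ f) atTop (𝓝 0) := by
  rw [Metric.tendsto_nhds]
  intro e he
  have h1 := Metric.tendsto_nhds.1 hf (e / (|μ₁ - μ₀| + 1)) (by positivity)
  rw [eventually_inf_principal, ← comap_norm_atTop, eventually_comap] at h1
  filter_upwards [h1, eventually_ge_atTop R, eventually_ge_atTop 0] with C hC hCR hC0
  rw [dist_zero_right]
  have := intervalIntegral.norm_integral_le_of_norm_le_const (a := μ₀) (b := μ₁)
    (C := e / (|μ₁ - μ₀| + 1))
    (f := fun μ => f (arcPoint C μ) * (Complex.I * arcPoint C μ)) fun μ hμ => by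
      have := hC (arcPoint C μ) (norm_arcPoint hC0 μ) (hS C hCR μ (Set.uIoc_subset_uIcc hμ))
      rw [dist_zero_right] at this
      calc _ = ‖arcPoint C μ * f (arcPoint C μ)‖ := by simp [mul_comm]
        _ ≤ _ := this.le
  refine this.trans_lt ?_
  rw [div_mul_eq_mul_div, div_lt_iff₀ (by positivity)]
  nlinarith [abs_nonneg (μ₁ - μ₀)]

lemma le_norm_mul_add_mul_I {v : ℂ} (hv : ‖v‖ = 1) (s y : ℝ) :
    s ≤ ‖v * (s + y * Complex.I)‖ := by
  rw [norm_mul, hv, one_mul]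
  simpa using Complex.re_le_norm (s + y * Complex.I)

/-- Segments at distance `C` do not contribute in the limit if `z f(z) → 0`. -/
lemma tendsto_segInt {f : ℂ → ℂ} {S : Set ℂ} {R δ : ℝ} {v : ℂ} (hv : ‖v‖ = 1)
    (hS : ∀ s ≥ R, ∀ y ∈ Set.uIcc 0 δ, v * (s + y * Complex.I) ∈ S)
    (hf : Tendsto (fun z => z * f z) (Bornology.cobounded ℂ ⊓ 𝓟 S) (𝓝 0)) :
    Tendsto (fun C => segInt v δ C f) atTop (𝓝 0) := by
  rw [Metric.tendsto_nhds]
  intro e he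
  have h1 := Metric.tendsto_nhds.1 hf (e / (|δ| + 1)) (by positivity)
  rw [eventually_inf_principal, ← comap_norm_atTop, eventually_comap,
    eventually_atTop] at h1
  obtain ⟨N, h1⟩ := h1
  -- The points of the segment have different moduli, all at least `C`, so an explicit threshold `N`
  -- is needed. From `C ≥ 1` the factor `z` in `z f(z)` can be dropped.
  filter_upwards [eventually_ge_atTop N, eventually_ge_atTop R, eventually_ge_atTop 1]
    with C hC hCR hC1
  rw [dist_zero_right]
  have := intervalIntegral.norm_integral_le_of_norm_le_const (a := 0) (b := δ)
    (C := e / (|δ| + 1))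
    (f := fun y => f (v * (C + y * Complex.I)) * (Complex.I * v)) fun y hy => by
      have hle := le_norm_mul_add_mul_I hv C y
      have := h1 _ (hC.trans hle) _ rfl (hS C hCR y (Set.uIoc_subset_uIcc hy))
      rw [dist_zero_right, norm_mul] at this
      rw [norm_mul, norm_mul, hv, Complex.norm_I, mul_one, mul_one]
      refine le_trans ?_ this.le
      exact le_mul_of_one_le_left (norm_nonneg _) (hC1.trans hle)
  refine this.trans_lt ?_
  rw [div_mul_eq_mul_div, div_lt_iff₀ (by positivity), sub_zero]
  nlinarith [abs_nonneg δ]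

/-! ### Gaussian regularization -/

lemma norm_exp_neg_le_one {η : ℝ} (hη : 0 ≤ η) {w : ℂ} (hw : 0 ≤ w.re) :
    ‖Complex.exp (-(η * w))‖ ≤ 1 := by
  rw [Complex.norm_exp, Real.exp_le_one_iff]
  simp only [Complex.neg_re, Complex.mul_re, Complex.ofReal_re, Complex.ofReal_im, zero_mul,
    sub_zero, neg_nonpos]
  positivity

/-- A factor `exp(-ηcz²)` with `Re(cz²) ≥ |z|²/2` beats exponential growth. -/
lemma tendsto_mul_gaussian {f : ℂ → ℂ} {S : Set ℂ} {c : ℂ} {B b η : ℝ} (hη : 0 < η)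
    (hc : ∀ z ∈ S, ‖z‖ ^ 2 ≤ 2 * (c * z ^ 2).re)
    (hB : ∀ z ∈ S, ‖f z‖ ≤ B * Real.exp (b * ‖z‖)) :
    Tendsto (fun z => z * (f z * Complex.exp (-(η * (c * z ^ 2)))))
      (Bornology.cobounded ℂ ⊓ 𝓟 S) (𝓝 0) := by
  have h1 : Tendsto (fun r : ℝ => r * (b + 1 - η / 2 * r)) atTop atBot := by
    refine Tendsto.atTop_mul_atBot₀ tendsto_id ?_
    have := (tendsto_id (α := ℝ)).const_mul_atTop (half_pos hη)
    exact tendsto_atBot_add_const_left _ _ (tendsto_neg_atTop_atBot.comp this)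
  have h2 : Tendsto (fun z : ℂ => B * Real.exp (‖z‖ * (b + 1 - η / 2 * ‖z‖)))
      (Bornology.cobounded ℂ ⊓ 𝓟 S) (𝓝 0) := by
    have := (((Real.tendsto_exp_atBot.comp h1).comp
      (tendsto_norm_cobounded_atTop (E := ℂ))).mono_left
        (inf_le_left : _ ⊓ 𝓟 S ≤ _)).const_mul B
    simpa using this
  refine squeeze_zero_norm' ?_ h2
  rw [eventually_inf_principal]
  refine Eventually.of_forall fun z hz => ?_
  have hexp : ‖Complex.exp (-(η * (c * z ^ 2)))‖ ≤ Real.exp (-(η / 2 * ‖z‖ ^ 2)) := by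
    rw [Complex.norm_exp, Real.exp_le_exp]
    have := hc z hz
    simp only [Complex.neg_re, Complex.re_ofReal_mul]
    nlinarith
  -- The factor `z` is absorbed into the exponential, which raises the rate from `b` to `b + 1`.
  have hz1 : ‖z‖ ≤ Real.exp ‖z‖ := by linarith [Real.add_one_le_exp ‖z‖]
  have hB0 : 0 ≤ B * Real.exp (b * ‖z‖) := (norm_nonneg _).trans (hB z hz)
  rw [norm_mul, norm_mul]
  calc ‖z‖ * (‖f z‖ * ‖Complex.exp (-(η * (c * z ^ 2)))‖)
      ≤ Real.exp ‖z‖ * ((B * Real.exp (b * ‖z‖)) * Real.exp (-(η / 2 * ‖z‖ ^ 2))) := by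
        gcongr
        exact hB z hz
    _ = B * Real.exp (‖z‖ * (b + 1 - η / 2 * ‖z‖)) := by
        rw [mul_assoc, mul_left_comm, ← Real.exp_add, ← Real.exp_add]
        ring_nf

lemma integrable_mul_gaussian {m : Measure ℝ} {f : ℂ → ℂ} {γ w : ℝ → ℂ} {c : ℂ} {η : ℝ}
    (hη : 0 ≤ η) (hγ : Continuous γ) (hf : Integrable (fun s => f (γ s) * w s) m)
    (hc : ∀ᵐ s ∂m, 0 ≤ (c * γ s ^ 2).re) :
    Integrable (fun s => f (γ s) * Complex.exp (-(η * (c * γ s ^ 2))) * w s) m := by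
  have : (fun s => f (γ s) * Complex.exp (-(η * (c * γ s ^ 2))) * w s) =
      fun s => Complex.exp (-(η * (c * γ s ^ 2))) * (f (γ s) * w s) := by
    funext s; ring
  rw [this]
  refine hf.norm.mono' ?_ ?_
  · exact (Continuous.aestronglyMeasurable (by fun_prop)).mul hf.aestronglyMeasurable
  · filter_upwards [hc] with s hs
    rw [norm_mul]
    exact mul_le_of_le_one_left (norm_nonneg _) (norm_exp_neg_le_one hη hs)

/-- Dominated convergence: where `Re(cz²) ≥ 0` the regularizing factor has modulus at most 1, so the
unregularized integrand is a majorant. -/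
lemma tendsto_integral_mul_gaussian {m : Measure ℝ} {f : ℂ → ℂ} {γ w : ℝ → ℂ} {c : ℂ}
    (hγ : Continuous γ) (hf : Integrable (fun s => f (γ s) * w s) m)
    (hc : ∀ᵐ s ∂m, 0 ≤ (c * γ s ^ 2).re) :
    Tendsto (fun η : ℝ => ∫ s, f (γ s) * Complex.exp (-(η * (c * γ s ^ 2))) * w s ∂m)
      (𝓝[>] 0) (𝓝 (∫ s, f (γ s) * w s ∂m)) := by
  refine tendsto_integral_filter_of_dominated_convergence (fun s => ‖f (γ s) * w s‖) ?_ ?_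
    hf.norm ?_
  · filter_upwards [self_mem_nhdsWithin] with η hη
    exact (integrable_mul_gaussian (le_of_lt hη) hγ hf hc).aestronglyMeasurable
  · filter_upwards [self_mem_nhdsWithin] with η hη
    filter_upwards [hc] with s hs
    rw [mul_right_comm, norm_mul]
    exact mul_le_of_le_one_right (norm_nonneg _) (norm_exp_neg_le_one (le_of_lt hη) hs)
  · refine Eventually.of_forall fun s => ?_
    have : Continuous fun η : ℝ => f (γ s) * Complex.exp (-(η * (c * γ s ^ 2))) * w s := by
      fun_prop
    have := (this.tendsto 0).mono_left (nhdsWithin_le_nhds (s := Set.Ioi 0))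
    simpa using this

lemma tendsto_intervalIntegral_mul_gaussian {p q : ℝ} {f : ℂ → ℂ} {γ w : ℝ → ℂ} {c : ℂ}
    (hγ : Continuous γ) (hf : IntervalIntegrable (fun s => f (γ s) * w s) volume p q)
    (hc : ∀ s ∈ Set.uIcc p q, 0 ≤ (c * γ s ^ 2).re) :
    Tendsto (fun η : ℝ => ∫ s in p..q, f (γ s) * Complex.exp (-(η * (c * γ s ^ 2))) * w s)
      (𝓝[>] 0) (𝓝 (∫ s in p..q, f (γ s) * w s)) := by
  simp only [intervalIntegral.intervalIntegral_eq_integral_uIoc]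
  refine (tendsto_integral_mul_gaussian hγ (intervalIntegrable_iff.1 hf) ?_).const_smul _
  exact (ae_restrict_iff' measurableSet_uIoc).2
    (Eventually.of_forall fun s hs => hc s (Set.uIoc_subset_uIcc hs))

lemma exp_mul_ofReal_eq_arcPoint (μ s : ℝ) :
    Complex.exp (μ * Complex.I) * (s + (0 : ℝ) * Complex.I) = arcPoint s μ := by
  simp [arcPoint, mul_comm]

/-- Moving one edge of a sector to the other edge, shifted into the sector. -/
lemma arcIntegral_add_rayIntInfty {f : ℂ → ℂ} {S : Set ℂ} {c : ℂ} {B b R δ μ₀ μ₁ : ℝ}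
    (hR : 0 < R)
    (hpolar : ∀ r ≥ R, ∀ μ ∈ Set.uIcc μ₀ μ₁, arcPoint r μ ∈ S)
    (hstrip : ∀ s ≥ R, ∀ y ∈ Set.uIcc 0 δ,
      Complex.exp (μ₀ * Complex.I) * (s + y * Complex.I) ∈ S)
    (hpolar' : ∀ r > R, ∀ μ ∈ Set.Ioo (min μ₀ μ₁) (max μ₀ μ₁),
      DifferentiableAt ℂ f (arcPoint r μ))
    (hstrip' : ∀ s > R, ∀ y ∈ Set.Ioo (min 0 δ) (max 0 δ),
      DifferentiableAt ℂ f (Complex.exp (μ₀ * Complex.I) * (s + y * Complex.I)))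
    (hc : ∀ z ∈ S, ‖z‖ ^ 2 ≤ 2 * (c * z ^ 2).re)
    (hf : ContinuousOn f S) (hB : ∀ z ∈ S, ‖f z‖ ≤ B * Real.exp (b * ‖z‖))
    (h1 : IntegrableOn (fun s : ℝ => f (arcPoint s μ₁)) (Set.Ioi R))
    (h0 : IntegrableOn
      (fun s : ℝ => f (Complex.exp (μ₀ * Complex.I) * (s + δ * Complex.I))) (Set.Ioi R)) :
    arcIntegral R μ₀ μ₁ f + rayIntInfty (Complex.exp (μ₁ * Complex.I)) 0 R f =
      segInt (Complex.exp (μ₀ * Complex.I)) δ R f +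
        rayIntInfty (Complex.exp (μ₀ * Complex.I)) δ R f := by
  set v := Complex.exp (μ₀ * Complex.I) with hv
  set u := Complex.exp (μ₁ * Complex.I) with hu
  have hv1 : ‖v‖ = 1 := Complex.norm_exp_ofReal_mul_I _
  have hc0 : ∀ z ∈ S, 0 ≤ (c * z ^ 2).re := fun z hz => by
    have := hc z hz
    nlinarith [sq_nonneg ‖z‖]
  have hu_mem : ∀ s ∈ Set.Ioi R, u * ((s : ℂ) + (0 : ℝ) * Complex.I) ∈ S := fun s hs => by
    rw [hu, exp_mul_ofReal_eq_arcPoint]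
    exact hpolar s (le_of_lt hs) _ Set.right_mem_uIcc
  have hv_mem : ∀ s ∈ Set.Ioi R, v * ((s : ℂ) + δ * Complex.I) ∈ S := fun s hs =>
    hstrip s (le_of_lt hs) _ Set.right_mem_uIcc
  have h1' : IntegrableOn (fun s : ℝ => f (u * (s + (0 : ℝ) * Complex.I)) * u) (Set.Ioi R) := by
    simp only [hu, exp_mul_ofReal_eq_arcPoint]
    exact h1.mul_const _
  have h0' : IntegrableOn (fun s : ℝ => f (v * (s + δ * Complex.I)) * v) (Set.Ioi R) :=
    h0.mul_const _
  have hcu : ∀ᵐ s : ℝ ∂volume.restrict (Set.Ioi R),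
      0 ≤ (c * (u * ((s : ℂ) + (0 : ℝ) * Complex.I)) ^ 2).re :=
    (ae_restrict_iff' measurableSet_Ioi).2
      (Eventually.of_forall fun s hs => hc0 _ (hu_mem s hs))
  have hcv : ∀ᵐ s : ℝ ∂volume.restrict (Set.Ioi R),
      0 ≤ (c * (v * ((s : ℂ) + δ * Complex.I)) ^ 2).re :=
    (ae_restrict_iff' measurableSet_Ioi).2
      (Eventually.of_forall fun s hs => hc0 _ (hv_mem s hs))
  -- The identity for the regularized integrand, where the far arc and the far segment vanish as `C
  -- → ∞`.
  have key : ∀ η : ℝ, 0 < η →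
      arcIntegral R μ₀ μ₁ (fun z => f z * Complex.exp (-(η * (c * z ^ 2)))) +
        rayIntInfty u 0 R (fun z => f z * Complex.exp (-(η * (c * z ^ 2)))) =
      segInt v δ R (fun z => f z * Complex.exp (-(η * (c * z ^ 2)))) +
        rayIntInfty v δ R (fun z => f z * Complex.exp (-(η * (c * z ^ 2)))) := by
    intro η hη
    set g : ℂ → ℂ := fun z => f z * Complex.exp (-(η * (c * z ^ 2))) with hg
    have hgc : ContinuousOn g S := hf.mul (by fun_prop)
    have hgd : ∀ z, DifferentiableAt ℂ f z → DifferentiableAt ℂ g z := fun z hz =>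
      hz.mul (by fun_prop)
    have hg0 := tendsto_mul_gaussian hη hc hB
    have ht1 : Tendsto (fun C => arcIntegral R μ₀ μ₁ g + rayInt u 0 R C g) atTop
        (𝓝 (arcIntegral R μ₀ μ₁ g + rayIntInfty u 0 R g)) :=
      tendsto_const_nhds.add (intervalIntegral_tendsto_integral_Ioi R
        (integrable_mul_gaussian hη.le (by fun_prop) h1' hcu) tendsto_id)
    have ht2 : Tendsto (fun C => arcIntegral C μ₀ μ₁ g - segInt v δ C g +
        (segInt v δ R g + rayInt v δ R C g)) atTop
        (𝓝 (0 - 0 + (segInt v δ R g + rayIntInfty v δ R g))) :=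
      ((tendsto_arcIntegral hpolar hg0).sub (tendsto_segInt hv1 hstrip hg0)).add
        (tendsto_const_nhds.add (intervalIntegral_tendsto_integral_Ioi R
          (integrable_mul_gaussian hη.le (by fun_prop) h0' hcv) tendsto_id))
    rw [sub_zero, zero_add] at ht2
    refine tendsto_nhds_unique (ht1.congr' ?_) ht2
    filter_upwards [eventually_ge_atTop R] with C hC
    -- The integral over the unshifted edge `arg z = μ₀` occurs in both identities and cancels at
    -- finite `C`, so its convergence is never needed.
    have e1 := arcIntegral_add_rayInt hR hC (fun r hr => hpolar r hr.1) hgc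
      (fun r hr μ hμ => hgd _ (hpolar' r hr μ hμ))
    have e2 := rayInt_add_segInt hC (fun r hr => hstrip r hr.1) hgc
      (fun r hr μ hμ => hgd _ (hstrip' r hr μ hμ))
    linear_combination e1 + e2
  -- Both sides converge to their unregularized values as `η → 0⁺`.
  have hL := (tendsto_intervalIntegral_mul_gaussian (p := μ₀) (q := μ₁) (f := f)
      (γ := arcPoint R) (w := fun μ => Complex.I * arcPoint R μ) (c := c) (by fun_prop)
      (ContinuousOn.intervalIntegrable ((hf.comp (by fun_prop)
        fun μ hμ => hpolar R le_rfl μ hμ).mul (by fun_prop)))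
      (fun μ hμ => hc0 _ (hpolar R le_rfl μ hμ))).add
    (tendsto_integral_mul_gaussian (by fun_prop) h1' hcu)
  have hRt := (tendsto_intervalIntegral_mul_gaussian (p := 0) (q := δ) (f := f)
      (γ := fun y : ℝ => v * (R + y * Complex.I)) (w := fun _ => Complex.I * v) (c := c)
      (by fun_prop)
      (ContinuousOn.intervalIntegrable ((hf.comp (by fun_prop)
        fun y hy => hstrip R le_rfl y hy).mul (by fun_prop)))
      (fun y hy => hc0 _ (hstrip R le_rfl y hy))).add
    (tendsto_integral_mul_gaussian (by fun_prop) h0' hcv)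
  refine tendsto_nhds_unique (hL.congr' ?_) hRt
  filter_upwards [self_mem_nhdsWithin] with η hη
  exact key η hη

/-! ### Geometry of the two sectors -/

/-- The part of the two closed sectors `-π ≤ arg z ≤ -2π/3` and `-π/3 ≤ arg z ≤ 0` outside the
disc of radius `R`, in Cartesian coordinates. -/
def cubicSectors (R : ℝ) : Set ℂ := {z | R ≤ ‖z‖ ∧ z.im ≤ 0 ∧ z.im ^ 2 ≤ 3 * z.re ^ 2}

lemma isClosed_cubicSectors (R : ℝ) : IsClosed (cubicSectors R) := by
  refine (isClosed_le continuous_const continuous_norm).inter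
    ((isClosed_le Complex.continuous_im continuous_const).inter
      (isClosed_le (Complex.continuous_im.pow 2) (by fun_prop)))

lemma cubicSectors_subset_lowerExterior (R : ℝ) : cubicSectors R ⊆ lowerExterior R :=
  fun _ hz => ⟨hz.2.1, hz.1⟩

lemma mem_interior_lowerExterior {R : ℝ} {z : ℂ} (h1 : z.im < 0) (h2 : R < ‖z‖) :
    z ∈ interior (lowerExterior R) := by
  have ho : IsOpen {z : ℂ | z.im < 0 ∧ R < ‖z‖} :=
    (isOpen_lt Complex.continuous_im continuous_const).inter
      (isOpen_lt continuous_const continuous_norm)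
  have hsub : {z : ℂ | z.im < 0 ∧ R < ‖z‖} ⊆ lowerExterior R := fun w hw => ⟨hw.1.le, hw.2.le⟩
  exact interior_maximal hsub ho ⟨h1, h2⟩

lemma arcPoint_re (r μ : ℝ) : (arcPoint r μ).re = r * Real.cos μ := by
  simp [arcPoint, Complex.exp_ofReal_mul_I_re]

lemma arcPoint_im (r μ : ℝ) : (arcPoint r μ).im = r * Real.sin μ := by
  simp [arcPoint, Complex.exp_ofReal_mul_I_im]

lemma arcPoint_mul_arcPoint (r s μ ν : ℝ) :
    arcPoint r μ * arcPoint s ν = arcPoint (r * s) (μ + ν) := by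
  simp only [arcPoint, Complex.ofReal_mul, Complex.ofReal_add, add_mul, Complex.exp_add]
  ring

lemma neg_arcPoint (r μ : ℝ) : -arcPoint r μ = arcPoint r (μ + Real.pi) := by
  simp only [arcPoint, Complex.ofReal_add, add_mul, Complex.exp_add, Complex.exp_pi_mul_I]
  ring

lemma arcPoint_sub_two_pi (r μ : ℝ) : arcPoint r (μ - 2 * Real.pi) = arcPoint r μ := by
  apply Complex.ext <;> simp [arcPoint_re, arcPoint_im]

lemma arcPoint_mem_sectorD {R r μ : ℝ} (hR : 0 < R) (hr : R < r)
    (h1 : -(2 * Real.pi / 3) < μ) (h2 : μ < -(Real.pi / 3)) : arcPoint r μ ∈ sectorD R := by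
  have hr0 : 0 < r := hR.trans hr
  have harg : (arcPoint r μ).arg = μ := by
    rw [arcPoint, Complex.arg_real_mul _ hr0, Complex.exp_mul_I]
    exact Complex.arg_cos_add_sin_mul_I ⟨by linarith [Real.pi_pos], by linarith [Real.pi_pos]⟩
  refine ⟨by rwa [norm_arcPoint hr0.le], ?_, ?_⟩ <;> rwa [harg]

lemma alpha_eq_arcPoint : alpha = arcPoint 1 (2 * Real.pi / 3) := by
  simp only [alpha, arcPoint, Complex.ofReal_one, one_mul]
  congr 1
  push_cast
  ring

lemma alpha_sq_eq_arcPoint : alpha ^ 2 = arcPoint 1 (-(2 * Real.pi / 3)) := by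
  rw [sq, alpha_eq_arcPoint, arcPoint_mul_arcPoint, ← arcPoint_sub_two_pi]
  congr 1
  · ring
  · ring

lemma neg_alpha_eq_arcPoint : -alpha = arcPoint 1 (-(Real.pi / 3)) := by
  rw [alpha_eq_arcPoint, neg_arcPoint, ← arcPoint_sub_two_pi]
  congr 1
  ring

lemma arcPoint_mem_left {R r μ : ℝ} (hR : 0 < R) (hr : R < r)
    (h1 : -Real.pi < μ) (h2 : μ < -(2 * Real.pi / 3)) : arcPoint r μ ∈ alpha • sectorE R := by
  -- Division by `α` subtracts `2π/3` from the angle. The extra `2π` is chosen so that, after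
  -- negation and one subtraction of `2π`, the angle is `μ + π/3`, in the range that defines `D`.
  refine ⟨arcPoint r (μ - 2 * Real.pi / 3 + 2 * Real.pi), ?_, ?_⟩
  · change -arcPoint _ _ ∈ sectorD R
    rw [neg_arcPoint, ← arcPoint_sub_two_pi]
    exact arcPoint_mem_sectorD hR hr (by linarith) (by linarith)
  · simp only [smul_eq_mul]
    rw [alpha_eq_arcPoint, arcPoint_mul_arcPoint, ← arcPoint_sub_two_pi]
    congr 1 <;> ring

lemma arcPoint_mem_right {R r μ : ℝ} (hR : 0 < R) (hr : R < r)
    (h1 : -(Real.pi / 3) < μ) (h2 : μ < 0) : arcPoint r μ ∈ alpha ^ 2 • sectorE R := by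
  refine ⟨arcPoint r (μ + 2 * Real.pi / 3), ?_, ?_⟩
  · change -arcPoint _ _ ∈ sectorD R
    rw [neg_arcPoint, ← arcPoint_sub_two_pi]
    exact arcPoint_mem_sectorD hR hr (by linarith) (by linarith)
  · simp only [smul_eq_mul]
    rw [alpha_sq_eq_arcPoint, arcPoint_mul_arcPoint]
    congr 1 <;> ring

lemma arcPoint_mem_closure {R p q : ℝ} {T : Set ℂ} (hpq : p < q)
    (h : ∀ r > R, ∀ μ ∈ Set.Ioo p q, arcPoint r μ ∈ T) {r μ : ℝ} (hr : R ≤ r)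
    (hμ : μ ∈ Set.Icc p q) : arcPoint r μ ∈ closure T := by
  have hcont : Continuous fun x : ℝ × ℝ => arcPoint x.1 x.2 := by
    unfold arcPoint; fun_prop
  have hmem : (r, μ) ∈ closure (Set.Ioi R ×ˢ Set.Ioo p q) := by
    rw [closure_prod_eq, closure_Ioi, closure_Ioo hpq.ne]
    exact ⟨hr, hμ⟩
  exact map_mem_closure (f := fun x : ℝ × ℝ => arcPoint x.1 x.2) hcont hmem
    fun x hx => h x.1 hx.1 x.2 hx.2

/-- The inequality says `|z|² ≤ 4 (Re z)²`, that is, `cos (arg z) ≥ 1/2`. -/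
lemma abs_arg_le_pi_div_three {z : ℂ} (hre : 0 ≤ z.re) (h : z.im ^ 2 ≤ 3 * z.re ^ 2) :
    |z.arg| ≤ Real.pi / 3 := by
  by_cases hz : z = 0
  · rw [hz, Complex.arg_zero, abs_zero]
    positivity
  have hn : 0 < ‖z‖ := norm_pos_iff.2 hz
  have h4 : ‖z‖ ^ 2 = z.re ^ 2 + z.im ^ 2 := by
    rw [Complex.sq_norm, Complex.normSq_apply]; ring
  have hcos : 1 / 2 ≤ Real.cos z.arg := by
    rw [Complex.cos_arg hz, le_div_iff₀ hn]
    exact (abs_le_of_sq_le_sq' (by nlinarith) hre).2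
  rw [← Real.cos_abs] at hcos
  by_contra! hlt
  have := Real.cos_lt_cos_of_nonneg_of_le_pi (by positivity) (Complex.abs_arg_le_pi z) hlt
  rw [Real.cos_pi_div_three] at this
  linarith

lemma arcPoint_norm_arg (z : ℂ) : arcPoint ‖z‖ z.arg = z := Complex.norm_mul_exp_arg_mul_I z

/-- Transfers the asymptotic hypotheses to the Cartesian description; the reverse inclusion is not
needed. The edges and the circle `|z| = R` are reached only through the closure. -/
lemma cubicSectors_subset_closedSectors {R : ℝ} (hR : 0 < R) :
    cubicSectors R ⊆ closedSectors R := by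
  rintro z ⟨hz, him, h3⟩
  have hpi := Real.pi_pos
  rcases le_total 0 z.re with hre | hre
  · right
    have h1 := abs_le.1 (abs_arg_le_pi_div_three hre h3)
    have h2 : z.arg ≤ 0 := by
      rcases him.lt_or_eq with h | h
      · exact (Complex.arg_neg_iff.2 h).le
      · exact (Complex.arg_eq_zero_iff.2 ⟨hre, h⟩).le
    rw [← arcPoint_norm_arg z]
    exact arcPoint_mem_closure (by linarith)
      (fun r hr μ hμ => arcPoint_mem_right hR hr hμ.1 hμ.2) hz ⟨h1.1, h2⟩
  · left
    have h1 := abs_le.1 (abs_arg_le_pi_div_three (z := -z) (by simpa using hre) (by simpa using h3))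
    have h2 : 0 ≤ (-z).arg := Complex.arg_nonneg_iff.2 (by simpa using him)
    have h4 : z = arcPoint ‖z‖ ((-z).arg - Real.pi) := by
      have h5 : arcPoint ‖z‖ (-z).arg = -z := by
        rw [← norm_neg z, arcPoint_norm_arg]
      rw [← neg_inj, neg_arcPoint, sub_add_cancel, h5]
    rw [h4]
    exact arcPoint_mem_closure (p := -Real.pi) (q := -(2 * Real.pi / 3)) (by linarith)
      (fun r hr μ hμ => arcPoint_mem_left hR hr hμ.1 hμ.2) hz ⟨by linarith, by linarith⟩

lemma neg_alpha_eq : -alpha = ⟨1 / 2, -(√3 / 2)⟩ := by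
  rw [neg_alpha_eq_arcPoint]
  apply Complex.ext <;> simp [arcPoint_re, arcPoint_im]

lemma cos_two_pi_div_three : Real.cos (2 * Real.pi / 3) = -(1 / 2) := by
  rw [show 2 * Real.pi / 3 = Real.pi - Real.pi / 3 by ring, Real.cos_pi_sub,
    Real.cos_pi_div_three]

lemma sin_two_pi_div_three : Real.sin (2 * Real.pi / 3) = √3 / 2 := by
  rw [show 2 * Real.pi / 3 = Real.pi - Real.pi / 3 by ring, Real.sin_pi_sub,
    Real.sin_pi_div_three]

lemma alpha_sq_eq : alpha ^ 2 = ⟨-(1 / 2), -(√3 / 2)⟩ := by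
  rw [alpha_sq_eq_arcPoint]
  apply Complex.ext <;>
    simp [arcPoint_re, arcPoint_im, cos_two_pi_div_three, sin_two_pi_div_three]

lemma norm_neg_alpha : ‖-alpha‖ = 1 := by
  rw [neg_alpha_eq_arcPoint, norm_arcPoint zero_le_one]

lemma norm_alpha_sq : ‖alpha ^ 2‖ = 1 := by
  rw [alpha_sq_eq_arcPoint, norm_arcPoint zero_le_one]

lemma neg_alpha_eq_exp : -alpha = Complex.exp ((-(Real.pi / 3) : ℝ) * Complex.I) := by
  rw [neg_alpha_eq_arcPoint, arcPoint, Complex.ofReal_one, one_mul]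

lemma alpha_sq_eq_exp : alpha ^ 2 = Complex.exp ((-(2 * Real.pi / 3) : ℝ) * Complex.I) := by
  rw [alpha_sq_eq_arcPoint, arcPoint, Complex.ofReal_one, one_mul]

lemma strip_right_im (s y : ℝ) : (-alpha * (s + y * Complex.I)).im = (y - √3 * s) / 2 := by
  rw [neg_alpha_eq]
  simp only [Complex.mul_im, Complex.add_re, Complex.add_im, Complex.ofReal_re, Complex.ofReal_im,
    Complex.mul_re, Complex.I_re, Complex.I_im]
  ring

lemma strip_right_re (s y : ℝ) : (-alpha * (s + y * Complex.I)).re = (s + √3 * y) / 2 := by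
  rw [neg_alpha_eq]
  simp only [Complex.mul_im, Complex.add_re, Complex.add_im, Complex.ofReal_re, Complex.ofReal_im,
    Complex.mul_re, Complex.I_re, Complex.I_im]
  ring

lemma strip_left_im (s y : ℝ) : (alpha ^ 2 * (s + y * Complex.I)).im = -(y + √3 * s) / 2 := by
  rw [alpha_sq_eq]
  simp only [Complex.mul_im, Complex.add_re, Complex.add_im, Complex.ofReal_re, Complex.ofReal_im,
    Complex.mul_re, Complex.I_re, Complex.I_im]
  ring

lemma strip_left_re (s y : ℝ) : (alpha ^ 2 * (s + y * Complex.I)).re = (-s + √3 * y) / 2 := by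
  rw [alpha_sq_eq]
  simp only [Complex.mul_im, Complex.add_re, Complex.add_im, Complex.ofReal_re, Complex.ofReal_im,
    Complex.mul_re, Complex.I_re, Complex.I_im]
  ring

/-- The right one of the two sectors. -/
def rightSector (R : ℝ) : Set ℂ := cubicSectors R ∩ {z | 0 ≤ z.re}

/-- The left one of the two sectors. -/
def leftSector (R : ℝ) : Set ℂ := cubicSectors R ∩ {z | z.re ≤ 0}

section
variable {R ε : ℝ}

/-- The bound `ε < √3 R` keeps the shifted ray below the real axis, since the imaginary part is `(y
- √3 s)/2`; `y ≥ 0` means that the shift goes into the sector. -/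
lemma strip_right_mem (hR : 0 < R) (hεR : ε < √3 * R) {s y : ℝ} (hs : R ≤ s)
    (hy : y ∈ Set.Icc 0 ε) : -alpha * (s + y * Complex.I) ∈ rightSector R := by
  have h3 : √3 ^ 2 = 3 := Real.sq_sqrt (by norm_num)
  have h30 : 0 < √3 := by positivity
  have hys : 0 ≤ √3 * s * y := mul_nonneg (mul_nonneg h30.le (hR.le.trans hs)) hy.1
  refine ⟨⟨hs.trans (le_norm_mul_add_mul_I norm_neg_alpha s y), ?_, ?_⟩, ?_⟩
  · rw [strip_right_im]
    nlinarith [hy.2]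
  · have e : 3 * ((s + √3 * y) / 2) ^ 2 - ((y - √3 * s) / 2) ^ 2 =
        2 * (√3 * s * y) + 2 * y ^ 2 := by
      linear_combination (3 * y ^ 2 - s ^ 2) / 4 * h3
    rw [strip_right_im, strip_right_re]
    nlinarith [sq_nonneg y]
  · rw [Set.mem_ofPred_eq, strip_right_re]
    have := mul_nonneg h30.le hy.1
    linarith

lemma strip_left_mem (hR : 0 < R) (hεR : ε < √3 * R) {s y : ℝ} (hs : R ≤ s)
    (hy : y ∈ Set.Icc (-ε) 0) : alpha ^ 2 * (s + y * Complex.I) ∈ leftSector R := by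
  have h3 : √3 ^ 2 = 3 := Real.sq_sqrt (by norm_num)
  have h30 : 0 < √3 := by positivity
  have hys : √3 * s * y ≤ 0 :=
    mul_nonpos_of_nonneg_of_nonpos (mul_nonneg h30.le (hR.le.trans hs)) hy.2
  refine ⟨⟨hs.trans (le_norm_mul_add_mul_I norm_alpha_sq s y), ?_, ?_⟩, ?_⟩
  · rw [strip_left_im]
    nlinarith [hy.1]
  · have e : 3 * ((-s + √3 * y) / 2) ^ 2 - (-(y + √3 * s) / 2) ^ 2 =
        -2 * (√3 * s * y) + 2 * y ^ 2 := by
      linear_combination (3 * y ^ 2 - s ^ 2) / 4 * h3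
    rw [strip_left_im, strip_left_re]
    nlinarith [sq_nonneg y]
  · rw [Set.mem_ofPred_eq, strip_left_re]
    have := mul_nonpos_of_nonneg_of_nonpos h30.le hy.2
    linarith

lemma strip_right_interior (hεR : ε < √3 * R) {s y : ℝ} (hs : R < s) (hy : y ≤ ε) :
    -alpha * (s + y * Complex.I) ∈ interior (lowerExterior R) := by
  refine mem_interior_lowerExterior ?_
    (hs.trans_le (le_norm_mul_add_mul_I norm_neg_alpha s y))
  rw [strip_right_im]
  nlinarith [show 0 < √3 by positivity]

lemma strip_left_interior (hεR : ε < √3 * R) {s y : ℝ} (hs : R < s) (hy : -ε ≤ y) :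
    alpha ^ 2 * (s + y * Complex.I) ∈ interior (lowerExterior R) := by
  refine mem_interior_lowerExterior ?_
    (hs.trans_le (le_norm_mul_add_mul_I norm_alpha_sq s y))
  rw [strip_left_im]
  nlinarith [show 0 < √3 by positivity]

lemma arcPoint_mem_rightSector (hR : 0 < R) {r μ : ℝ} (hr : R ≤ r)
    (hμ : μ ∈ Set.Icc (-(Real.pi / 3)) 0) : arcPoint r μ ∈ rightSector R := by
  have hr0 : 0 < r := hR.trans_le hr
  have hpi := Real.pi_pos
  have hcos : 1 / 2 ≤ Real.cos μ := by
    rw [← Real.cos_pi_div_three, ← Real.cos_neg μ]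
    exact Real.cos_le_cos_of_nonneg_of_le_pi (by linarith [hμ.2]) (by linarith)
      (by linarith [hμ.1])
  have hsin : Real.sin μ ≤ 0 := Real.sin_nonpos_of_nonpos_of_neg_pi_le hμ.2 (by linarith [hμ.1])
  have hsq : Real.sin μ ^ 2 ≤ 3 * Real.cos μ ^ 2 := by
    rw [Real.sin_sq]; nlinarith
  refine ⟨⟨by rwa [norm_arcPoint hr0.le], ?_, ?_⟩, ?_⟩
  · rw [arcPoint_im]; exact mul_nonpos_of_nonneg_of_nonpos hr0.le hsin
  · rw [arcPoint_im, arcPoint_re]; nlinarith [sq_nonneg r]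
  · rw [Set.mem_ofPred_eq, arcPoint_re]; exact mul_nonneg hr0.le (by linarith)

lemma arcPoint_mem_leftSector (hR : 0 < R) {r μ : ℝ} (hr : R ≤ r)
    (hμ : μ ∈ Set.Icc (-Real.pi) (-(2 * Real.pi / 3))) : arcPoint r μ ∈ leftSector R := by
  -- Reflection in the imaginary axis.
  have h := arcPoint_mem_rightSector hR (μ := -Real.pi - μ) hr
    ⟨by linarith [hμ.2], by linarith [hμ.1]⟩
  have hc : Real.cos (-Real.pi - μ) = -Real.cos μ := by
    rw [← Real.cos_neg, show -(-Real.pi - μ) = μ + Real.pi by ring, Real.cos_add_pi]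
  have hs : Real.sin (-Real.pi - μ) = Real.sin μ := by
    rw [show -Real.pi - μ = -(μ + Real.pi) by ring, Real.sin_neg, Real.sin_add_pi, neg_neg]
  simpa [rightSector, leftSector, cubicSectors, arcPoint_re, arcPoint_im, hc, hs,
    norm_arcPoint (hR.le.trans hr)] using h

lemma arcPoint_mem_lowerExterior (hR : 0 < R) {r μ : ℝ} (hr : R ≤ r)
    (hμ : μ ∈ Set.Icc (-Real.pi) 0) : arcPoint r μ ∈ lowerExterior R := by
  have hr0 : 0 < r := hR.trans_le hr
  refine ⟨?_, by rwa [norm_arcPoint hr0.le]⟩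
  rw [arcPoint_im]
  exact mul_nonpos_of_nonneg_of_nonpos hr0.le
    (Real.sin_nonpos_of_nonpos_of_neg_pi_le hμ.2 hμ.1)

lemma arcPoint_mem_interior (hR : 0 < R) {r μ : ℝ} (hr : R < r)
    (hμ : μ ∈ Set.Ioo (-Real.pi) 0) : arcPoint r μ ∈ interior (lowerExterior R) := by
  have hr0 : 0 < r := hR.trans hr
  refine mem_interior_lowerExterior ?_ (by rwa [norm_arcPoint hr0.le])
  rw [arcPoint_im]
  exact mul_neg_of_pos_of_neg hr0 (Real.sin_neg_of_neg_of_neg_pi_lt hμ.2 hμ.1)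

/-- Here `c = exp(iπ/3)`: the argument of `z²` lies in `[-2π/3, 0]`, and the rotation centres it in
`[-π/3, π/3]`, where the cosine is at least `1/2`. In coordinates the difference of the two sides is
`2(-Im z)(√3 Re z + Im z)`. -/
lemma norm_sq_le_right {z : ℂ} (hz : z ∈ rightSector R) :
    ‖z‖ ^ 2 ≤ 2 * ((⟨1 / 2, √3 / 2⟩ : ℂ) * z ^ 2).re := by
  have h3 : √3 ^ 2 = 3 := Real.sq_sqrt (by norm_num)
  have h30 : 0 < √3 := by positivity
  obtain ⟨⟨-, him, hsq⟩, hre⟩ := hz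
  have hre' : 0 ≤ z.re := hre
  have h : -z.im ≤ √3 * z.re :=
    neg_le.1 (abs_le_of_sq_le_sq' (by rw [mul_pow, h3]; exact hsq)
      (mul_nonneg h30.le hre')).1
  rw [Complex.sq_norm, Complex.normSq_apply, sq z]
  simp only [Complex.mul_re, Complex.mul_im]
  nlinarith [mul_nonneg (neg_nonneg.2 him) (sub_nonneg.2 h)]

lemma norm_sq_le_left {z : ℂ} (hz : z ∈ leftSector R) :
    ‖z‖ ^ 2 ≤ 2 * ((⟨1 / 2, -(√3 / 2)⟩ : ℂ) * z ^ 2).re := by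
  have h3 : √3 ^ 2 = 3 := Real.sq_sqrt (by norm_num)
  have h30 : 0 < √3 := by positivity
  obtain ⟨⟨-, him, hsq⟩, hre⟩ := hz
  have hre' : 0 ≤ -z.re := neg_nonneg.2 hre
  have h : -z.im ≤ √3 * -z.re :=
    neg_le.1 (abs_le_of_sq_le_sq' (by rw [mul_pow, h3, neg_sq]; exact hsq)
      (mul_nonneg h30.le hre')).1
  rw [Complex.sq_norm, Complex.normSq_apply, sq z]
  simp only [Complex.mul_re, Complex.mul_im]
  nlinarith [mul_nonneg (neg_nonneg.2 him) (sub_nonneg.2 h)]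

end

/-! ### Size of the cubic exponential, of `θ` and of `ν` -/

/-- The exponent is `t Im(z³)`, whose sign on the sectors can be read off from the inequalities that
define `cubicSectors`. -/
lemma norm_exp_cubic (z : ℂ) (t : ℝ) :
    ‖Complex.exp (-Complex.I * z ^ 3 * t)‖ =
      Real.exp (t * (z.im * (3 * z.re ^ 2 - z.im ^ 2))) := by
  rw [Complex.norm_exp]
  congr 1
  simp only [pow_succ, pow_zero, one_mul, Complex.mul_re, Complex.mul_im, Complex.neg_re,
    Complex.neg_im, Complex.I_re, Complex.I_im, Complex.ofReal_re, Complex.ofReal_im]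
  ring

lemma norm_exp_cubic_le_one {R t : ℝ} (ht : 0 ≤ t) {z : ℂ} (hz : z ∈ cubicSectors R) :
    ‖Complex.exp (-Complex.I * z ^ 3 * t)‖ ≤ 1 := by
  rw [norm_exp_cubic, Real.exp_le_one_iff]
  exact mul_nonpos_of_nonneg_of_nonpos ht
    (mul_nonpos_of_nonpos_of_nonneg hz.2.1 (sub_nonneg.2 hz.2.2))

/-- As `(-α)³ = -1`, the exponent is `-t Im((s + iε)³)`. This is the Gaussian decay gained by
shifting the ray. -/
lemma norm_exp_cubic_right (s ε t : ℝ) :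
    ‖Complex.exp (-Complex.I * (-alpha * (s + ε * Complex.I)) ^ 3 * t)‖ =
      Real.exp (t * (ε ^ 3 - 3 * ε * s ^ 2)) := by
  have h3 : √3 ^ 2 = 3 := Real.sq_sqrt (by norm_num)
  rw [norm_exp_cubic, strip_right_im, strip_right_re]
  congr 2
  grind

lemma norm_exp_cubic_left (s ε t : ℝ) :
    ‖Complex.exp (-Complex.I * (alpha ^ 2 * (s + (-ε : ℝ) * Complex.I)) ^ 3 * t)‖ =
      Real.exp (t * (ε ^ 3 - 3 * ε * s ^ 2)) := by
  have h3 : √3 ^ 2 = 3 := Real.sq_sqrt (by norm_num)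
  rw [norm_exp_cubic, strip_left_im, strip_left_re]
  congr 2
  grind

/-- A continuous function on a closed set that vanishes at infinity is bounded. -/
lemma exists_norm_le_of_tendsto {f : ℂ → ℂ} {K : Set ℂ} (hK : IsClosed K)
    (hf : ContinuousOn f K) (h0 : Tendsto f (Bornology.cobounded ℂ ⊓ 𝓟 K) (𝓝 0)) :
    ∃ B, 0 ≤ B ∧ ∀ z ∈ K, ‖f z‖ ≤ B := by
  have h1 := Metric.tendsto_nhds.1 h0 1 one_pos
  rw [eventually_inf_principal, ← comap_norm_atTop, eventually_comap, eventually_atTop] at h1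
  obtain ⟨N, h1⟩ := h1
  obtain ⟨B, hB⟩ := ((isCompact_closedBall (0 : ℂ) N).inter_right hK).exists_bound_of_continuousOn
    (hf.mono Set.inter_subset_right)
  refine ⟨max B 1, by positivity, fun z hz => ?_⟩
  rcases le_total N ‖z‖ with h | h
  · have := h1 _ h z rfl hz
    rw [dist_zero_right] at this
    exact this.le.trans (le_max_right _ _)
  · exact (hB z ⟨by simpa using h, hz⟩).trans (le_max_left _ _)

lemma continuousOn_nu {a R : ℝ} (hR : 0 < R) (haR : 4 * |a| ^ 3 < 27 * R ^ 6) :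
    ContinuousOn (nu a) {z | R ≤ ‖z‖} := fun z hz =>
  (differentiableAt_nu (haR.trans_le (by gcongr; exact hz))).continuousAt.continuousWithinAt

lemma exists_norm_nu_sub_le {a R : ℝ} (hR : 0 < R) (haR : 4 * |a| ^ 3 < 27 * R ^ 6) :
    ∃ M, 0 ≤ M ∧ ∀ z : ℂ, R ≤ ‖z‖ → ‖nu a z - z‖ ≤ M :=
  exists_norm_le_of_tendsto (f := fun z => nu a z - z)
    (isClosed_le continuous_const continuous_norm)
    ((continuousOn_nu hR haR).sub continuousOn_id)
    ((tendsto_nu_sub a).mono_left inf_le_left)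

/-! ### The integrand and differentiation under the integral sign -/

/-- The `j`-th derivative in `x` of `exp (iν(z)x - iz³t) θ(z)`. -/
def kernel (a t : ℝ) (θ : ℂ → ℂ) (j : ℕ) (x : ℝ) (z : ℂ) : ℂ :=
  Complex.exp (Complex.I * nu a z * x - Complex.I * z ^ 3 * t) * θ z * (Complex.I * nu a z) ^ j

lemma kernel_eq (a t : ℝ) (θ : ℂ → ℂ) (j : ℕ) (x : ℝ) (z : ℂ) :
    kernel a t θ j x z = Complex.exp (Complex.I * nu a z * x) *
      (Complex.I * nu a z) ^ j * (Complex.exp (-Complex.I * z ^ 3 * t) * θ z) := by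
  rw [kernel, sub_eq_add_neg, Complex.exp_add, neg_mul, neg_mul]
  ring

lemma norm_exp_I_mul_le (w : ℂ) (x : ℝ) :
    ‖Complex.exp (Complex.I * w * x)‖ ≤ Real.exp (|x| * ‖w‖) := by
  refine (Complex.norm_exp_le_exp_norm _).trans (le_of_eq ?_)
  congr 1
  simp [mul_comm]

lemma pow_le_exp_mul {r : ℝ} (hr : 0 ≤ r) (j : ℕ) : r ^ j ≤ Real.exp (j * r) := by
  rw [Real.exp_nat_mul]
  exact pow_le_pow_left₀ hr (by linarith [Real.add_one_le_exp r]) j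

/-- Powers of `ν` are absorbed into an exponential, so that integrability of `exp(A|ν|)` times the
remaining factors, for all `A`, controls every derivative in `x` at once. -/
lemma norm_exp_mul_pow_le {w : ℂ} {x A : ℝ} (hx : |x| ≤ A) (j : ℕ) :
    ‖Complex.exp (Complex.I * w * x) * (Complex.I * w) ^ j‖ ≤ Real.exp ((A + j) * ‖w‖) := by
  rw [norm_mul, norm_pow, norm_mul, Complex.norm_I, one_mul, add_mul, Real.exp_add]
  gcongr
  · refine (norm_exp_I_mul_le w x).trans ?_
    gcongr
  · exact pow_le_exp_mul (norm_nonneg w) j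

section
variable {m : Measure ℝ} {a t : ℝ} {θ : ℂ → ℂ} {γ w : ℝ → ℂ}

lemma integrable_kernel (hN : AEStronglyMeasurable (fun s => nu a (γ s)) m)
    (hg : AEStronglyMeasurable
      (fun s => Complex.exp (-Complex.I * γ s ^ 3 * t) * θ (γ s) * w s) m)
    (h : ∀ A : ℝ, Integrable (fun s => Real.exp (A * ‖nu a (γ s)‖) *
      ‖Complex.exp (-Complex.I * γ s ^ 3 * t) * θ (γ s) * w s‖) m) (j : ℕ) (x : ℝ) :
    Integrable (fun s => kernel a t θ j x (γ s) * w s) m := by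
  simp only [kernel_eq, mul_assoc (_ * _ ^ j)]
  refine (h (|x| + j)).mono' ?_ (Eventually.of_forall fun s => ?_)
  · refine AEStronglyMeasurable.mul ?_ hg
    have : Continuous fun z : ℂ => Complex.exp (Complex.I * z * x) * (Complex.I * z) ^ j := by
      fun_prop
    exact this.comp_aestronglyMeasurable hN
  · rw [norm_mul]
    exact mul_le_mul_of_nonneg_right (norm_exp_mul_pow_le le_rfl j) (norm_nonneg _)

lemma hasDerivAt_kernel (a t : ℝ) (θ : ℂ → ℂ) (j : ℕ) (x : ℝ) (z : ℂ) :
    HasDerivAt (fun x : ℝ => kernel a t θ j x z) (kernel a t θ (j + 1) x z) x := by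
  have h1 : HasDerivAt (fun x : ℝ => Complex.I * nu a z * x - Complex.I * z ^ 3 * t)
      (Complex.I * nu a z) x := by
    simpa using ((Complex.ofRealCLM.hasDerivAt (x := x)).const_mul
      (Complex.I * nu a z)).sub_const (Complex.I * z ^ 3 * t)
  have h2 := (h1.cexp.mul_const (θ z)).mul_const ((Complex.I * nu a z) ^ j)
  refine h2.congr_deriv ?_
  rw [kernel]
  ring

lemma hasDerivAt_integral_kernel (hN : AEStronglyMeasurable (fun s => nu a (γ s)) m)
    (hg : AEStronglyMeasurable
      (fun s => Complex.exp (-Complex.I * γ s ^ 3 * t) * θ (γ s) * w s) m)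
    (h : ∀ A : ℝ, Integrable (fun s => Real.exp (A * ‖nu a (γ s)‖) *
      ‖Complex.exp (-Complex.I * γ s ^ 3 * t) * θ (γ s) * w s‖) m) (j : ℕ) (x : ℝ) :
    HasDerivAt (fun x : ℝ => ∫ s, kernel a t θ j x (γ s) * w s ∂m)
      (∫ s, kernel a t θ (j + 1) x (γ s) * w s ∂m) x := by
  -- On the unit ball about `x` one has `|y| ≤ |x| + 1`, and the derivative carries the power `j +
  -- 1`; their sum is the rate of the majorant.
  refine (hasDerivAt_integral_of_dominated_loc_of_deriv_le
    (F' := fun x s => kernel a t θ (j + 1) x (γ s) * w s)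
    (Metric.ball_mem_nhds x one_pos)
    (Eventually.of_forall fun y => (integrable_kernel hN hg h j y).aestronglyMeasurable)
    (integrable_kernel hN hg h j x) (integrable_kernel hN hg h (j + 1) x).aestronglyMeasurable
    (Eventually.of_forall fun s y hy => ?_) (h (|x| + 1 + ((j + 1 : ℕ) : ℝ)))
    (Eventually.of_forall fun s y _ => (hasDerivAt_kernel a t θ j y (γ s)).mul_const (w s))).2
  rw [kernel_eq, mul_assoc (_ * _ ^ _), norm_mul]
  refine mul_le_mul_of_nonneg_right (norm_exp_mul_pow_le ?_ _) (norm_nonneg _)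
  rw [Metric.mem_ball, Real.dist_eq] at hy
  have := abs_sub_abs_le_abs_sub y x
  linarith

lemma hasDerivAt_intervalIntegral_kernel {p q : ℝ} (hγ : Continuous γ) (hw : Continuous w)
    (hN : ContinuousOn (fun s => nu a (γ s)) (Set.uIcc p q))
    (hθ : ContinuousOn (fun s => θ (γ s)) (Set.uIcc p q)) (j : ℕ) (x : ℝ) :
    HasDerivAt (fun x : ℝ => ∫ s in p..q, kernel a t θ j x (γ s) * w s)
      (∫ s in p..q, kernel a t θ (j + 1) x (γ s) * w s) x := by
  simp only [intervalIntegral.intervalIntegral_eq_integral_uIoc]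
  have hg : ContinuousOn (fun s => Complex.exp (-Complex.I * γ s ^ 3 * t) * θ (γ s) * w s)
      (Set.uIcc p q) :=
    ((Continuous.continuousOn (by fun_prop)).mul hθ).mul hw.continuousOn
  have hsub : Set.uIoc p q ⊆ Set.uIcc p q := Set.uIoc_subset_uIcc
  refine (hasDerivAt_integral_kernel
    ((hN.mono hsub).aestronglyMeasurable measurableSet_uIoc)
    ((hg.mono hsub).aestronglyMeasurable measurableSet_uIoc) (fun A => ?_) j x).const_smul _
  have hc : ContinuousOn (fun s => Real.exp (A * ‖nu a (γ s)‖) *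
      ‖Complex.exp (-Complex.I * γ s ^ 3 * t) * θ (γ s) * w s‖) (Set.uIcc p q) :=
    (Real.continuous_exp.comp_continuousOn (continuousOn_const.mul hN.norm)).mul hg.norm
  exact (hc.integrableOn_compact isCompact_uIcc).mono_set hsub

end

/-! ### Domination on the shifted rays -/

lemma integrable_exp_quadratic {b : ℝ} (hb : 0 < b) (c d : ℝ) :
    Integrable fun s : ℝ => Real.exp (-b * s ^ 2 + c * s + d) := by
  have := (integrable_cexp_quadratic (b := b) (by simpa using hb) c d).norm
  refine this.congr (Eventually.of_forall fun s => ?_)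
  simp only [Complex.norm_exp]
  congr 1
  have : (-(b : ℂ) * s ^ 2 + c * s + d) = ((-b * s ^ 2 + c * s + d : ℝ) : ℂ) := by push_cast; rfl
  rw [this, Complex.ofReal_re]

/-- Domination of the kernel on a ray along which `exp (-iz³t)` decays like a Gaussian. -/
lemma integrableOn_exp_nu_mul {a R M B t ε δ : ℝ} {θ : ℂ → ℂ} {v : ℂ} (hR : 0 < R) (hv : ‖v‖ = 1)
    (haR : 4 * |a| ^ 3 < 27 * R ^ 6) (hε : 0 < ε) (ht : 0 < t)
    (hM : ∀ z : ℂ, R ≤ ‖z‖ → ‖nu a z - z‖ ≤ M)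
    (hγ : ∀ s > R, v * ((s : ℂ) + δ * Complex.I) ∈ cubicSectors R)
    (hθc : ContinuousOn θ (cubicSectors R)) (hθB : ∀ z ∈ cubicSectors R, ‖θ z‖ ≤ B)
    (hexp : ∀ s : ℝ, ‖Complex.exp (-Complex.I * (v * (s + δ * Complex.I)) ^ 3 * t)‖ =
      Real.exp (t * (ε ^ 3 - 3 * ε * s ^ 2))) (w : ℂ) :
    AEStronglyMeasurable (fun s : ℝ => nu a (v * (s + δ * Complex.I)))
      (volume.restrict (Set.Ioi R)) ∧
    AEStronglyMeasurable (fun s : ℝ => Complex.exp (-Complex.I * (v * (s + δ * Complex.I)) ^ 3 * t)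
      * θ (v * (s + δ * Complex.I)) * w) (volume.restrict (Set.Ioi R)) ∧
    ∀ A : ℝ, IntegrableOn (fun s : ℝ => Real.exp (A * ‖nu a (v * (s + δ * Complex.I))‖) *
      ‖Complex.exp (-Complex.I * (v * (s + δ * Complex.I)) ^ 3 * t)
        * θ (v * (s + δ * Complex.I)) * w‖) (Set.Ioi R) := by
  have hN : ContinuousOn (fun s : ℝ => nu a (v * (s + δ * Complex.I))) (Set.Ioi R) :=
    (continuousOn_nu hR haR).comp (by fun_prop) fun s hs => (hγ s hs).1
  have hg : ContinuousOn (fun s : ℝ => Complex.exp (-Complex.I * (v * (s + δ * Complex.I)) ^ 3 * t)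
      * θ (v * (s + δ * Complex.I)) * w) (Set.Ioi R) :=
    ((Continuous.continuousOn (by fun_prop)).mul
      (hθc.comp (by fun_prop) fun s hs => hγ s hs)).mul continuousOn_const
  refine ⟨hN.aestronglyMeasurable measurableSet_Ioi, hg.aestronglyMeasurable measurableSet_Ioi,
    fun A => ?_⟩
  -- The majorant combines `|ν| ≤ s + |δ| + M` with the cubic factor `exp(t(ε³ - 3εs²))`.
  have hint := ((integrable_exp_quadratic (b := 3 * ε * t) (by positivity) |A|
    (|A| * (|δ| + M) + t * ε ^ 3)).mul_const (B * ‖w‖)).integrableOn (s := Set.Ioi R)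
  refine hint.mono' ?_ ?_
  · exact ((Real.continuous_exp.comp_continuousOn (continuousOn_const.mul hN.norm)).mul
      hg.norm).aestronglyMeasurable measurableSet_Ioi
  refine (ae_restrict_iff' measurableSet_Ioi).2 (Eventually.of_forall fun s hs => ?_)
  have hz := hγ s hs
  have hs0 : 0 < s := hR.trans hs
  have hzn : ‖v * (s + δ * Complex.I)‖ ≤ s + |δ| := by
    rw [norm_mul, hv, one_mul]
    refine (norm_add_le _ _).trans (le_of_eq ?_)
    simp [abs_of_pos hs0]
  have hnu : ‖nu a (v * (s + δ * Complex.I))‖ ≤ s + |δ| + M := by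
    have h1 := hM _ hz.1
    have h2 := norm_sub_norm_le (nu a (v * (s + δ * Complex.I))) (v * (s + δ * Complex.I))
    linarith
  rw [Real.norm_of_nonneg (by positivity), norm_mul, norm_mul, hexp]
  calc Real.exp (A * ‖nu a (v * (s + δ * Complex.I))‖) *
        (Real.exp (t * (ε ^ 3 - 3 * ε * s ^ 2)) * ‖θ (v * (s + δ * Complex.I))‖ * ‖w‖)
      ≤ Real.exp (|A| * (s + |δ| + M)) *
        (Real.exp (t * (ε ^ 3 - 3 * ε * s ^ 2)) * B * ‖w‖) := by
        refine mul_le_mul (Real.exp_le_exp.2 ?_) ?_ (by positivity) (by positivity)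
        · exact (mul_le_mul_of_nonneg_right (le_abs_self A) (norm_nonneg _)).trans
            (mul_le_mul_of_nonneg_left hnu (abs_nonneg A))
        · gcongr
          exact hθB _ hz
    _ = _ := by
        rw [mul_assoc _ B, ← mul_assoc (Real.exp _) (Real.exp _), ← Real.exp_add]
        ring_nf

/-! ### Deformation of `Γ₊` into `Γ` -/

/-- `∫ f(z) dz` along the whole contour `Γ`. -/
def gammaIntegralInfty (R ε : ℝ) (f : ℂ → ℂ) : ℂ :=
  -(segInt (alpha ^ 2) (-ε) R f + rayIntInfty (alpha ^ 2) (-ε) R f)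
    + arcIntegral R (-(2 * Real.pi / 3)) (-(Real.pi / 3)) f
    + (segInt (-alpha) ε R f + rayIntInfty (-alpha) ε R f)

/-- Both ends of the contour are written as outward paths, the left one with a minus sign and shift
`-ε`, so that the sector lemmas apply to each. -/
lemma gammaIntegral_eq (R ε C : ℝ) (f : ℂ → ℂ) :
    gammaIntegral R ε C f =
      -(segInt (alpha ^ 2) (-ε) R f + rayInt (alpha ^ 2) (-ε) R C f)
        + arcIntegral R (-(2 * Real.pi / 3)) (-(Real.pi / 3)) f
        + (segInt (-alpha) ε R f + rayInt (-alpha) ε R C f) := by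
  have h1 : lineIntegral (-(alpha ^ 2 * Complex.I * ε)) (alpha ^ 2) C R f =
      -rayInt (alpha ^ 2) (-ε) R C f := by
    rw [lineIntegral, rayInt, intervalIntegral.integral_symm]
    congr 1
    refine intervalIntegral.integral_congr fun s _ => ?_
    congr 2
    push_cast
    ring
  have h2 : lineIntegral (alpha ^ 2 * R) (-(alpha ^ 2 * Complex.I)) ε 0 f =
      -segInt (alpha ^ 2) (-ε) R f := by
    have := intervalIntegral.integral_comp_neg (a := (0 : ℝ)) (b := ε) fun y : ℝ =>
      f (alpha ^ 2 * (R + y * Complex.I)) * (Complex.I * alpha ^ 2)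
    rw [neg_zero] at this
    rw [lineIntegral, segInt, intervalIntegral.integral_symm (-ε) 0, ← this, neg_neg,
      intervalIntegral.integral_symm, ← intervalIntegral.integral_neg]
    refine intervalIntegral.integral_congr fun s _ => ?_
    rw [← mul_neg]
    congr 2
    · push_cast
      ring
    · ring
  have h3 : lineIntegral (-(alpha * R)) (-(alpha * Complex.I)) 0 ε f =
      segInt (-alpha) ε R f := by
    rw [lineIntegral, segInt]
    refine intervalIntegral.integral_congr fun s _ => ?_
    congr 2
    · ring
    · ring
  have h4 : lineIntegral (-(alpha * Complex.I * ε)) (-alpha) R C f = rayInt (-alpha) ε R C f := by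
    rw [lineIntegral, rayInt]
    refine intervalIntegral.integral_congr fun s _ => ?_
    congr 2
    ring
  rw [gammaIntegral, h1, h2, h3, h4]
  ring

lemma boundaryDIntegral_eq (R C : ℝ) (f : ℂ → ℂ) :
    boundaryDIntegral R C f = -rayInt (alpha ^ 2) 0 R C f
      + arcIntegral R (-(2 * Real.pi / 3)) (-(Real.pi / 3)) f + rayInt (-alpha) 0 R C f := by
  have h : ∀ (v : ℂ), lineIntegral 0 v R C f = rayInt v 0 R C f := by
    intro v
    rw [lineIntegral, rayInt]
    refine intervalIntegral.integral_congr fun s _ => ?_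
    congr 2
    push_cast
    ring
  have h' : lineIntegral 0 (alpha ^ 2) C R f = -lineIntegral 0 (alpha ^ 2) R C f := by
    rw [lineIntegral, lineIntegral, intervalIntegral.integral_symm]
  rw [boundaryDIntegral, h', h, h]

/-- At most exponential growth in `|z|`, which is what the Gaussian regularization can beat. -/
lemma kernel_zero_norm_le {a t R M x : ℝ} {θ : ℂ → ℂ} (ht : 0 ≤ t)
    (hM : ∀ z : ℂ, R ≤ ‖z‖ → ‖nu a z - z‖ ≤ M) {z : ℂ} (hz : z ∈ cubicSectors R) :
    ‖kernel a t θ 0 x z‖ ≤ ‖θ z‖ * Real.exp (|x| * M) * Real.exp (|x| * ‖z‖) := by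
  have h1 := norm_sub_norm_le (nu a z) z
  have h2 := hM z hz.1
  have h3 : ‖nu a z‖ ≤ M + ‖z‖ := by linarith
  rw [kernel_eq, pow_zero, mul_one, norm_mul, norm_mul, mul_assoc ‖θ z‖, ← Real.exp_add, ← mul_add]
  calc ‖Complex.exp (Complex.I * nu a z * x)‖ * (‖Complex.exp (-Complex.I * z ^ 3 * t)‖ * ‖θ z‖)
      ≤ Real.exp (|x| * (M + ‖z‖)) * (1 * ‖θ z‖) := by
        refine mul_le_mul ((norm_exp_I_mul_le _ _).trans ?_) ?_ (by positivity) (by positivity)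
        · gcongr
        · gcongr
          exact norm_exp_cubic_le_one ht hz
    _ = _ := by ring

/-- On the real axis `|exp(iνx)| = exp(-x Im ν)`, and `Im ν(s) = Im(ν(s) - s)` is bounded. Hence `θ
∈ L¹` suffices for convergence there. -/
lemma kernel_ofReal_norm_le {a t R M x s : ℝ} {θ : ℂ → ℂ}
    (hM : ∀ z : ℂ, R ≤ ‖z‖ → ‖nu a z - z‖ ≤ M) (hs : R ≤ |s|) :
    ‖kernel a t θ 0 x s‖ ≤ Real.exp (|x| * M) * ‖θ s‖ := by
  rw [kernel, pow_zero, mul_one, norm_mul]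
  refine mul_le_mul_of_nonneg_right ?_ (norm_nonneg _)
  rw [Complex.norm_exp, Real.exp_le_exp]
  have h1 := (Complex.abs_im_le_norm _).trans (hM s (by simpa using hs))
  rw [Complex.sub_im, Complex.ofReal_im, sub_zero] at h1
  have h2 : (Complex.I * nu a s * x - Complex.I * (s : ℂ) ^ 3 * t).re = -(x * (nu a s).im) := by
    rw [← Complex.ofReal_pow, Complex.sub_re, mul_assoc, mul_assoc, Complex.I_mul_re,
      Complex.I_mul_re, ← Complex.ofReal_mul, Complex.ofReal_im, mul_comm (nu a s),
      Complex.im_ofReal_mul]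
    ring
  rw [h2]
  refine (neg_le_abs _).trans ?_
  rw [abs_mul]
  gcongr

section
variable {a t R : ℝ} {θ : ℂ → ℂ}

lemma continuousOn_kernel (hR : 0 < R) (haR : 4 * |a| ^ 3 < 27 * R ^ 6)
    (hθ : ContinuousOn θ (lowerExterior R)) (j : ℕ) (x : ℝ) :
    ContinuousOn (kernel a t θ j x) (lowerExterior R) := by
  have hN : ContinuousOn (nu a) (lowerExterior R) :=
    (continuousOn_nu hR haR).mono fun z hz => hz.2
  have hE : ContinuousOn (fun z => Complex.exp (Complex.I * nu a z * x - Complex.I * z ^ 3 * t))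
      (lowerExterior R) :=
    Complex.continuous_exp.comp_continuousOn
      (((continuousOn_const.mul hN).mul continuousOn_const).sub (by fun_prop))
  exact (hE.mul hθ).mul ((continuousOn_const.mul hN).pow j)

lemma differentiableAt_kernel (hR : 0 < R) (haR : 4 * |a| ^ 3 < 27 * R ^ 6)
    (hθ : DifferentiableOn ℂ θ (interior (lowerExterior R))) (j : ℕ) (x : ℝ) {z : ℂ}
    (hz : z ∈ interior (lowerExterior R)) : DifferentiableAt ℂ (kernel a t θ j x) z := by
  have hN : DifferentiableAt ℂ (nu a) z :=
    differentiableAt_nu (haR.trans_le (by gcongr; exact (interior_subset hz).2))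
  have h2 := hθ.differentiableAt (isOpen_interior.mem_nhds hz)
  unfold kernel
  fun_prop

end

lemma arcPoint_zero (s : ℝ) : arcPoint s 0 = s := by simp [arcPoint]

lemma arcPoint_neg_pi (s : ℝ) : arcPoint s (-Real.pi) = ((-s : ℝ) : ℂ) := by
  apply Complex.ext <;> simp [arcPoint_re, arcPoint_im]

/-- The contour `Γ₊` may be replaced by `Γ`. -/
lemma gammaPlusIntegral_kernel {a R M B t ε : ℝ} {θ : ℂ → ℂ} (hR : 0 < R)
    (haR : 4 * |a| ^ 3 < 27 * R ^ 6) (hε : 0 < ε) (hεR : ε < √3 * R) (ht : 0 < t)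
    (hM : ∀ z : ℂ, R ≤ ‖z‖ → ‖nu a z - z‖ ≤ M)
    (hθ₁ : MemLpGammaPlus R 1 θ) (hθc : ContinuousOn θ (lowerExterior R))
    (hθd : DifferentiableOn ℂ θ (interior (lowerExterior R)))
    (hθB : ∀ z ∈ cubicSectors R, ‖θ z‖ ≤ B) (x : ℝ) :
    gammaPlusIntegral R (kernel a t θ 0 x) = gammaIntegralInfty R ε (kernel a t θ 0 x) := by
  have hpi := Real.pi_pos
  have hint : IntegrableOn (fun s : ℝ => θ s) (Set.Iic (-R) ∪ Set.Ici R) := by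
    have := hθ₁.1
    rwa [memLp_one_iff_integrable] at this
  have hcont := continuousOn_kernel (t := t) hR haR hθc 0 x
  have hcont' := hcont.mono (cubicSectors_subset_lowerExterior R)
  have hdiff : ∀ z ∈ interior (lowerExterior R), DifferentiableAt ℂ (kernel a t θ 0 x) z :=
    fun z hz => differentiableAt_kernel hR haR hθd 0 x hz
  have hgrow : ∀ z ∈ cubicSectors R, ‖kernel a t θ 0 x z‖ ≤
      (B * Real.exp (|x| * M)) * Real.exp (|x| * ‖z‖) := fun z hz =>
    (kernel_zero_norm_le ht.le hM hz).trans (by gcongr; exact hθB z hz)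
  have hreal : ∀ s : ℝ, R ≤ |s| → (s : ℂ) ∈ lowerExterior R := fun s hs =>
    ⟨by simp, by simpa using hs⟩
  have hr : IntegrableOn (fun s : ℝ => kernel a t θ 0 x (arcPoint s 0)) (Set.Ioi R) := by
    simp only [arcPoint_zero]
    have h1 : IntegrableOn (fun s : ℝ => θ s) (Set.Ioi R) :=
      hint.mono_set (Set.Ioi_subset_Ici_self.trans Set.subset_union_right)
    refine (h1.norm.const_mul (Real.exp (|x| * M))).mono' ?_ ?_
    · refine ContinuousOn.aestronglyMeasurable (hcont.comp (by fun_prop) fun s hs => ?_)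
        measurableSet_Ioi
      exact hreal s ((le_of_lt hs).trans (le_abs_self s))
    · exact (ae_restrict_iff' measurableSet_Ioi).2 (Eventually.of_forall fun s hs =>
        kernel_ofReal_norm_le hM ((le_of_lt hs).trans (le_abs_self s)))
  have hl : IntegrableOn (fun s : ℝ => kernel a t θ 0 x (arcPoint s (-Real.pi))) (Set.Ioi R) := by
    simp only [arcPoint_neg_pi]
    have h1 : IntegrableOn (fun s : ℝ => θ ((-s : ℝ) : ℂ)) (Set.Ioi R) := by
      have h0 : IntegrableOn (fun s : ℝ => θ s) (Set.Iic (-R)) :=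
        hint.mono_set Set.subset_union_left
      exact (h0.comp_neg).mono_set fun s hs => by
        simpa using le_of_lt hs
    refine (h1.norm.const_mul (Real.exp (|x| * M))).mono' ?_ ?_
    · refine ContinuousOn.aestronglyMeasurable (hcont.comp (by fun_prop) fun s hs => ?_)
        measurableSet_Ioi
      exact hreal _ (by rw [abs_neg]; exact (le_of_lt hs).trans (le_abs_self s))
    · exact (ae_restrict_iff' measurableSet_Ioi).2 (Eventually.of_forall fun s hs =>
        kernel_ofReal_norm_le hM (by rw [abs_neg]; exact (le_of_lt hs).trans (le_abs_self s)))
  have hθc' := hθc.mono (cubicSectors_subset_lowerExterior R)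
  have right := arcIntegral_add_rayIntInfty (f := kernel a t θ 0 x) (S := rightSector R)
    (c := ⟨1 / 2, √3 / 2⟩) (δ := ε) (μ₀ := -(Real.pi / 3)) (μ₁ := 0) hR
    (fun r hr μ hμ => arcPoint_mem_rightSector hR hr (by rwa [Set.uIcc_of_le (by linarith)] at hμ))
    (fun s hs y hy => by
      rw [← neg_alpha_eq_exp]
      exact strip_right_mem hR hεR hs (by rwa [Set.uIcc_of_le hε.le] at hy))
    (fun r hr μ hμ => hdiff _ (arcPoint_mem_interior hR hr (by
      rw [min_eq_left (by linarith), max_eq_right (by linarith)] at hμ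
      exact ⟨by linarith [hμ.1], hμ.2⟩)))
    (fun s hs y hy => hdiff _ (by
      rw [← neg_alpha_eq_exp]
      rw [max_eq_right hε.le] at hy
      exact strip_right_interior hεR hs hy.2.le))
    (fun z hz => norm_sq_le_right hz) (hcont'.mono Set.inter_subset_left)
    (fun z hz => hgrow z hz.1) hr (by
      rw [← neg_alpha_eq_exp]
      obtain ⟨h1, h2, h3⟩ := integrableOn_exp_nu_mul hR norm_neg_alpha haR hε ht hM
        (fun s hs => (strip_right_mem hR hεR (le_of_lt hs) ⟨hε.le, le_rfl⟩).1) hθc' hθB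
        (fun s => norm_exp_cubic_right s ε t) 1
      simpa [IntegrableOn] using integrable_kernel h1 h2 h3 0 x)
  -- Here the angle decreases from `-2π/3` to `-π`, so moving into the sector is a shift by `-ε`.
  have left := arcIntegral_add_rayIntInfty (f := kernel a t θ 0 x) (S := leftSector R)
    (c := ⟨1 / 2, -(√3 / 2)⟩) (δ := -ε) (μ₀ := -(2 * Real.pi / 3)) (μ₁ := -Real.pi) hR
    (fun r hr μ hμ => arcPoint_mem_leftSector hR hr (by rwa [Set.uIcc_of_ge (by linarith)] at hμ))
    (fun s hs y hy => by
      rw [← alpha_sq_eq_exp]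
      exact strip_left_mem hR hεR hs (by rwa [Set.uIcc_of_ge (by linarith)] at hy))
    (fun r hr μ hμ => hdiff _ (arcPoint_mem_interior hR hr (by
      rw [min_eq_right (by linarith), max_eq_left (by linarith)] at hμ
      exact ⟨hμ.1, by linarith [hμ.2]⟩)))
    (fun s hs y hy => hdiff _ (by
      rw [← alpha_sq_eq_exp]
      rw [min_eq_right (by linarith)] at hy
      exact strip_left_interior hεR hs hy.1.le))
    (fun z hz => norm_sq_le_left hz) (hcont'.mono Set.inter_subset_left)
    (fun z hz => hgrow z hz.1) hl (by
      rw [← alpha_sq_eq_exp]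
      obtain ⟨h1, h2, h3⟩ := integrableOn_exp_nu_mul hR norm_alpha_sq haR hε ht hM
        (fun s hs => (strip_left_mem hR hεR (le_of_lt hs) ⟨le_rfl, by linarith⟩).1) hθc' hθB
        (fun s => norm_exp_cubic_left s ε t) 1
      simpa [IntegrableOn] using integrable_kernel h1 h2 h3 0 x)
  rw [← neg_alpha_eq_exp] at right
  rw [← alpha_sq_eq_exp] at left
  have harc : ∀ p ∈ Set.Icc (-Real.pi) 0, ∀ q ∈ Set.Icc (-Real.pi) 0, IntervalIntegrable
      (fun μ => kernel a t θ 0 x (arcPoint R μ) * (Complex.I * arcPoint R μ)) volume p q := by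
    intro p hp q hq
    refine ContinuousOn.intervalIntegrable ((hcont.comp (by fun_prop) fun μ hμ => ?_).mul
      (by fun_prop))
    exact arcPoint_mem_lowerExterior hR le_rfl (Set.uIcc_subset_Icc hp hq hμ)
  have hsplit : arcIntegral R (-Real.pi) 0 (kernel a t θ 0 x) =
      -arcIntegral R (-(2 * Real.pi / 3)) (-Real.pi) (kernel a t θ 0 x)
      + arcIntegral R (-(2 * Real.pi / 3)) (-(Real.pi / 3)) (kernel a t θ 0 x)
      + arcIntegral R (-(Real.pi / 3)) 0 (kernel a t θ 0 x) := by
    have m1 : -Real.pi ∈ Set.Icc (-Real.pi) 0 := ⟨by linarith, by linarith⟩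
    have m2 : -(2 * Real.pi / 3) ∈ Set.Icc (-Real.pi) 0 := ⟨by linarith, by linarith⟩
    have m3 : -(Real.pi / 3) ∈ Set.Icc (-Real.pi) 0 := ⟨by linarith, by linarith⟩
    have m4 : (0 : ℝ) ∈ Set.Icc (-Real.pi) 0 := ⟨by linarith, by linarith⟩
    simp only [arcIntegral]
    rw [← intervalIntegral.integral_symm,
      intervalIntegral.integral_add_adjacent_intervals (harc _ m1 _ m2) (harc _ m2 _ m3),
      intervalIntegral.integral_add_adjacent_intervals (harc _ m1 _ m3) (harc _ m3 _ m4)]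
  have hrayR : rayIntInfty (Complex.exp ((0 : ℝ) * Complex.I)) 0 R (kernel a t θ 0 x) =
      ∫ s in Set.Ici R, kernel a t θ 0 x (s : ℂ) := by
    rw [integral_Ici_eq_integral_Ioi, rayIntInfty]
    simp
  have hrayL : rayIntInfty (Complex.exp ((-Real.pi : ℝ) * Complex.I)) 0 R (kernel a t θ 0 x) =
      -∫ s in Set.Iic (-R), kernel a t θ 0 x (s : ℂ) := by
    rw [← integral_comp_neg_Ioi, rayIntInfty, ← integral_neg]
    simp
  rw [hrayR] at right
  rw [hrayL] at left
  rw [gammaPlusIntegral, gammaIntegralInfty, hsplit]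
  linear_combination right - left

/-! ### Derivatives and truncations of the integral over `Γ` -/

section
variable {a R M B t ε : ℝ} {θ : ℂ → ℂ}

lemma hasDerivAt_gammaIntegralInfty (hR : 0 < R)
    (haR : 4 * |a| ^ 3 < 27 * R ^ 6) (hε : 0 < ε) (hεR : ε < √3 * R) (ht : 0 < t)
    (hM : ∀ z : ℂ, R ≤ ‖z‖ → ‖nu a z - z‖ ≤ M) (hθc : ContinuousOn θ (lowerExterior R))
    (hθB : ∀ z ∈ cubicSectors R, ‖θ z‖ ≤ B) (j : ℕ) (x : ℝ) :
    HasDerivAt (fun x => gammaIntegralInfty R ε (kernel a t θ j x))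
      (gammaIntegralInfty R ε (kernel a t θ (j + 1) x)) x := by
  have hpi := Real.pi_pos
  have hθc' := hθc.mono (cubicSectors_subset_lowerExterior R)
  have hν := continuousOn_nu hR haR
  have hl : ∀ y ∈ Set.uIcc 0 (-ε), alpha ^ 2 * ((R : ℂ) + y * Complex.I) ∈ cubicSectors R :=
    fun y hy => (strip_left_mem hR hεR le_rfl
      (by rwa [Set.uIcc_of_ge (by linarith)] at hy)).1
  have hr : ∀ y ∈ Set.uIcc 0 ε, -alpha * ((R : ℂ) + y * Complex.I) ∈ cubicSectors R :=
    fun y hy => (strip_right_mem hR hεR le_rfl (by rwa [Set.uIcc_of_le hε.le] at hy)).1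
  have harc : ∀ μ ∈ Set.uIcc (-(2 * Real.pi / 3)) (-(Real.pi / 3)),
      arcPoint R μ ∈ lowerExterior R := fun μ hμ => by
    rw [Set.uIcc_of_le (by linarith)] at hμ
    exact arcPoint_mem_lowerExterior hR le_rfl ⟨by linarith [hμ.1], by linarith [hμ.2]⟩
  obtain ⟨l1, l2, l3⟩ := integrableOn_exp_nu_mul hR norm_alpha_sq haR hε ht hM
    (fun s hs => (strip_left_mem hR hεR (le_of_lt hs) ⟨le_rfl, by linarith⟩).1) hθc' hθB
    (fun s => norm_exp_cubic_left s ε t) (alpha ^ 2)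
  obtain ⟨r1, r2, r3⟩ := integrableOn_exp_nu_mul hR norm_neg_alpha haR hε ht hM
    (fun s hs => (strip_right_mem hR hεR (le_of_lt hs) ⟨hε.le, le_rfl⟩).1) hθc' hθB
    (fun s => norm_exp_cubic_right s ε t) (-alpha)
  refine HasDerivAt.add (HasDerivAt.add (HasDerivAt.neg (HasDerivAt.add ?_ ?_)) ?_)
    (HasDerivAt.add ?_ ?_)
  · exact hasDerivAt_intervalIntegral_kernel
      (γ := fun y : ℝ => alpha ^ 2 * ((R : ℂ) + y * Complex.I))
      (w := fun _ => Complex.I * alpha ^ 2) (by fun_prop) (by fun_prop)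
      (hν.comp (by fun_prop) fun y hy => (hl y hy).1) (hθc'.comp (by fun_prop) hl) j x
  · exact hasDerivAt_integral_kernel l1 l2 l3 j x
  · exact hasDerivAt_intervalIntegral_kernel (γ := arcPoint R)
      (w := fun μ => Complex.I * arcPoint R μ) (by fun_prop) (by fun_prop)
      (hν.comp (by fun_prop) fun y hy => (harc y hy).2) (hθc.comp (by fun_prop) harc) j x
  · exact hasDerivAt_intervalIntegral_kernel
      (γ := fun y : ℝ => -alpha * ((R : ℂ) + y * Complex.I))
      (w := fun _ => Complex.I * -alpha) (by fun_prop) (by fun_prop)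
      (hν.comp (by fun_prop) fun y hy => (hr y hy).1) (hθc'.comp (by fun_prop) hr) j x
  · exact hasDerivAt_integral_kernel r1 r2 r3 j x

lemma tendsto_gammaIntegral (hR : 0 < R)
    (haR : 4 * |a| ^ 3 < 27 * R ^ 6) (hε : 0 < ε) (hεR : ε < √3 * R) (ht : 0 < t)
    (hM : ∀ z : ℂ, R ≤ ‖z‖ → ‖nu a z - z‖ ≤ M) (hθc : ContinuousOn θ (cubicSectors R))
    (hθB : ∀ z ∈ cubicSectors R, ‖θ z‖ ≤ B) (j : ℕ) (x : ℝ) :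
    Tendsto (fun C => gammaIntegral R ε C (kernel a t θ j x)) atTop
      (𝓝 (gammaIntegralInfty R ε (kernel a t θ j x))) := by
  simp only [gammaIntegral_eq]
  obtain ⟨l1, l2, l3⟩ := integrableOn_exp_nu_mul hR norm_alpha_sq haR hε ht hM
    (fun s hs => (strip_left_mem hR hεR (le_of_lt hs) ⟨le_rfl, by linarith⟩).1) hθc hθB
    (fun s => norm_exp_cubic_left s ε t) (alpha ^ 2)
  obtain ⟨r1, r2, r3⟩ := integrableOn_exp_nu_mul hR norm_neg_alpha haR hε ht hM
    (fun s hs => (strip_right_mem hR hεR (le_of_lt hs) ⟨hε.le, le_rfl⟩).1) hθc hθB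
    (fun s => norm_exp_cubic_right s ε t) (-alpha)
  exact ((tendsto_const_nhds.add (intervalIntegral_tendsto_integral_Ioi R
    (integrable_kernel l1 l2 l3 j x) tendsto_id)).neg.add tendsto_const_nhds).add
    (tendsto_const_nhds.add (intervalIntegral_tendsto_integral_Ioi R
      (integrable_kernel r1 r2 r3 j x) tendsto_id))

end

/-! ### Return from `Γ` to `∂D`, and linearity -/

/-- The contours `∂D` and `Γ` are equivalent for functions that are `o(1/z)` in the sectors. -/
lemma tendsto_boundaryDIntegral_sub {R ε : ℝ} {f : ℂ → ℂ} (hR : 0 < R) (hε : 0 < ε)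
    (hεR : ε < √3 * R) (hf : ContinuousOn f (cubicSectors R))
    (hd : ∀ z ∈ interior (lowerExterior R), DifferentiableAt ℂ f z)
    (h0 : Tendsto (fun z => z * f z) (Bornology.cobounded ℂ ⊓ 𝓟 (cubicSectors R)) (𝓝 0)) :
    Tendsto (fun C => boundaryDIntegral R C f - gammaIntegral R ε C f) atTop (𝓝 0) := by
  have hl : ∀ s : ℝ, R ≤ s → ∀ y ∈ Set.uIcc 0 (-ε),
      alpha ^ 2 * ((s : ℂ) + y * Complex.I) ∈ cubicSectors R := fun s hs y hy =>
    (strip_left_mem hR hεR hs (by rwa [Set.uIcc_of_ge (by linarith)] at hy)).1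
  have hr : ∀ s : ℝ, R ≤ s → ∀ y ∈ Set.uIcc 0 ε,
      -alpha * ((s : ℂ) + y * Complex.I) ∈ cubicSectors R := fun s hs y hy =>
    (strip_right_mem hR hεR hs (by rwa [Set.uIcc_of_le hε.le] at hy)).1
  -- For `C ≥ R` the difference of the two truncated integrals is exactly the difference of the two
  -- end segments at distance `C`.
  have ht := (tendsto_segInt norm_alpha_sq hl h0).sub (tendsto_segInt norm_neg_alpha hr h0)
  rw [sub_zero] at ht
  refine ht.congr' ?_
  filter_upwards [eventually_ge_atTop R] with C hC
  have e1 := rayInt_add_segInt hC (fun s hs => hl s hs.1) hf fun s hs y hy => hd _ (by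
    rw [min_eq_right (by linarith)] at hy
    exact strip_left_interior hεR hs hy.1.le)
  have e2 := rayInt_add_segInt hC (fun s hs => hr s hs.1) hf fun s hs y hy => hd _ (by
    rw [max_eq_right hε.le] at hy
    exact strip_right_interior hεR hs hy.2.le)
  rw [boundaryDIntegral_eq, gammaIntegral_eq]
  linear_combination e1 - e2

lemma gammaIntegral_const_mul (R ε C : ℝ) (c : ℂ) (f : ℂ → ℂ) :
    gammaIntegral R ε C (fun z => c * f z) = c * gammaIntegral R ε C f := by
  simp only [gammaIntegral, lineIntegral, arcIntegral, mul_assoc c,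
    intervalIntegral.integral_const_mul]
  ring

lemma gammaIntegral_add {R ε C : ℝ} {f g h : ℂ → ℂ} (hR : 0 < R) (hRC : R ≤ C) (hε : 0 < ε)
    (hεR : ε < √3 * R) (hf : ContinuousOn f (lowerExterior R))
    (hg : ContinuousOn g (lowerExterior R)) (hh : ∀ z ∈ lowerExterior R, h z = f z + g z) :
    gammaIntegral R ε C h = gammaIntegral R ε C f + gammaIntegral R ε C g := by
  have hpi := Real.pi_pos
  have hsub := cubicSectors_subset_lowerExterior R
  have hl : ∀ s : ℝ, R ≤ s → ∀ y ∈ Set.uIcc 0 (-ε),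
      alpha ^ 2 * ((s : ℂ) + y * Complex.I) ∈ lowerExterior R := fun s hs y hy =>
    hsub (strip_left_mem hR hεR hs (by rwa [Set.uIcc_of_ge (by linarith)] at hy)).1
  have hr : ∀ s : ℝ, R ≤ s → ∀ y ∈ Set.uIcc 0 ε,
      -alpha * ((s : ℂ) + y * Complex.I) ∈ lowerExterior R := fun s hs y hy =>
    hsub (strip_right_mem hR hεR hs (by rwa [Set.uIcc_of_le hε.le] at hy)).1
  have harc : ∀ μ ∈ Set.uIcc (-(2 * Real.pi / 3)) (-(Real.pi / 3)),
      arcPoint R μ ∈ lowerExterior R := fun μ hμ => by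
    rw [Set.uIcc_of_le (by linarith)] at hμ
    exact arcPoint_mem_lowerExterior hR le_rfl ⟨by linarith [hμ.1], by linarith [hμ.2]⟩
  have add : ∀ {p q : ℝ} {γ w : ℝ → ℂ}, Continuous γ → Continuous w →
      (∀ s ∈ Set.uIcc p q, γ s ∈ lowerExterior R) →
      (∫ s in p..q, h (γ s) * w s) =
        (∫ s in p..q, f (γ s) * w s) + ∫ s in p..q, g (γ s) * w s := by
    intro p q γ w hγ hw hmem
    refine (intervalIntegral.integral_congr fun s hs => ?_).trans (intervalIntegral.integral_add
      ((hf.comp hγ.continuousOn hmem).mul hw.continuousOn).intervalIntegrable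
      ((hg.comp hγ.continuousOn hmem).mul hw.continuousOn).intervalIntegrable)
    simp [hh _ (hmem s hs), add_mul]
  simp only [gammaIntegral_eq, rayInt, segInt, arcIntegral]
  rw [add (by fun_prop) (by fun_prop) (hl R le_rfl), add (by fun_prop) (by fun_prop) harc,
    add (by fun_prop) (by fun_prop) (hr R le_rfl),
    add (by fun_prop) (by fun_prop) fun s hs => hl s (by
      rw [Set.uIcc_of_le hRC] at hs; exact hs.1) _ Set.right_mem_uIcc,
    add (by fun_prop) (by fun_prop) fun s hs => hr s (by
      rw [Set.uIcc_of_le hRC] at hs; exact hs.1) _ Set.right_mem_uIcc]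
  ring

/-! ### Iterated derivatives and asymptotics at infinity -/

lemma iteratedDeriv_of_hasDerivAt {F : ℕ → ℝ → ℂ}
    (hF : ∀ j x, HasDerivAt (F j) (F (j + 1) x) x) (j : ℕ) : iteratedDeriv j (F 0) = F j := by
  induction j with
  | zero => exact iteratedDeriv_zero
  | succ j ih =>
    rw [iteratedDeriv_succ, ih]
    exact funext fun x => (hF j x).deriv

lemma contDiff_of_hasDerivAt {F : ℕ → ℝ → ℂ}
    (hF : ∀ j x, HasDerivAt (F j) (F (j + 1) x) x) (n : ℕ) : ContDiff ℝ n (F 0) := by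
  refine contDiff_of_differentiable_iteratedDeriv (n := n) fun m _ => ?_
  rw [iteratedDeriv_of_hasDerivAt hF]
  exact fun x => (hF m x).differentiableAt

lemma neg_I_pow_mul_kernel (a t : ℝ) (θ : ℂ → ℂ) (k : ℕ) (z : ℂ) :
    (-Complex.I) ^ k * kernel a t θ k 0 z =
      Complex.exp (-Complex.I * z ^ 3 * t) * θ z * nu a z ^ k := by
  have h : (-Complex.I) ^ k * Complex.I ^ k = 1 := by
    rw [← mul_pow, neg_mul, Complex.I_mul_I, neg_neg, one_pow]
  rw [kernel_eq, Complex.ofReal_zero, mul_zero, Complex.exp_zero, mul_pow]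
  linear_combination (nu a z ^ k * (Complex.exp (-Complex.I * z ^ 3 * t) * θ z)) * h

lemma tendsto_zero_of_isBigO {ψ : ℂ → ℂ} {n : ℕ} (hn : n ≠ 0) {l : Filter ℂ}
    (hl : l ≤ Bornology.cobounded ℂ) (h : ψ =O[l] fun z : ℂ => (z ^ n)⁻¹) : Tendsto ψ l (𝓝 0) := by
  refine h.trans_tendsto ?_
  have := ((tendsto_inv₀_cobounded (α := ℂ)).pow n).mono_left hl
  simpa [hn] using this

lemma isBigO_nu (a : ℝ) : nu a =O[Bornology.cobounded ℂ] fun z : ℂ => z := by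
  have h1 : (fun z => nu a z - z) =O[Bornology.cobounded ℂ] fun _ => (1 : ℂ) :=
    (tendsto_nu_sub a).isBigO_one ℂ
  have h2 : (fun _ : ℂ => (1 : ℂ)) =O[Bornology.cobounded ℂ] fun z : ℂ => z := by
    refine Asymptotics.IsBigO.of_bound 1 ?_
    filter_upwards [(tendsto_norm_cobounded_atTop (E := ℂ)).eventually_ge_atTop 1] with z hz
    simpa using hz
  simpa using (h1.trans h2).add (Asymptotics.isBigO_refl (fun z : ℂ => z) _)

/-- This is where `k ≤ 2` enters: the product is `O(|z|^(1 - 4 + k))`, hence `O(1/|z|)`. -/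
lemma tendsto_mul_exp_mul_nu_pow {R a t : ℝ} {ψ : ℂ → ℂ} {k : ℕ} (hk : k ≤ 2) (ht : 0 ≤ t)
    (h : ψ =O[Bornology.cobounded ℂ ⊓ 𝓟 (cubicSectors R)] fun z : ℂ => (z ^ 4)⁻¹) :
    Tendsto (fun z => z * (Complex.exp (-Complex.I * z ^ 3 * t) * ψ z * nu a z ^ k))
      (Bornology.cobounded ℂ ⊓ 𝓟 (cubicSectors R)) (𝓝 0) := by
  set l := Bornology.cobounded ℂ ⊓ 𝓟 (cubicSectors R) with hl
  have hle : l ≤ Bornology.cobounded ℂ := inf_le_left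
  have hE : (fun z : ℂ => Complex.exp (-Complex.I * z ^ 3 * t)) =O[l] fun _ => (1 : ℂ) := by
    refine Asymptotics.IsBigO.of_bound 1 ?_
    rw [hl, eventually_inf_principal]
    exact Eventually.of_forall fun z hz => by simpa using norm_exp_cubic_le_one ht hz
  have hge : ∀ᶠ z : ℂ in l, 1 ≤ ‖z‖ :=
    hle ((tendsto_norm_cobounded_atTop (E := ℂ)).eventually_ge_atTop 1)
  have hO := (Asymptotics.isBigO_refl (fun z : ℂ => z) l).mul
    ((hE.mul h).mul (((isBigO_nu a).mono hle).pow k))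
  refine tendsto_zero_of_isBigO one_ne_zero hle (hO.trans ?_)
  refine Asymptotics.IsBigO.of_bound 1 ?_
  filter_upwards [hge] with z hz
  have hz0 : 0 < ‖z‖ := one_pos.trans_le hz
  simp only [norm_mul, norm_inv, norm_pow, one_mul, pow_one]
  rw [← div_eq_inv_mul, ← mul_div_assoc, div_le_iff₀ (by positivity)]
  calc ‖z‖ * ‖z‖ ^ k ≤ ‖z‖ * ‖z‖ ^ 2 := by gcongr
    _ = ‖z‖⁻¹ * ‖z‖ ^ 4 := by field_simp

end VertexRewriting

end

/-! ### The main theorem -/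

theorem mainTheorem2 (a R ε : ℝ) (hR : 0 < R) (haR : 4 * |a| ^ 3 < 27 * R ^ 6)
    (hε : 0 < ε) (hεR : ε < Real.sqrt 3 * R)
    (θ φ ψ : ℂ → ℂ)
    (hθ₁ : VertexRewriting.MemLpGammaPlus R 1 θ)
    (hθ_top : VertexRewriting.MemLpGammaPlus R ⊤ θ)
    (hθ : ∀ z ∈ VertexRewriting.lowerExterior R, θ z = φ z + ψ z)
    (hφc : ContinuousOn φ (VertexRewriting.lowerExterior R))
    (hφd : DifferentiableOn ℂ φ (interior (VertexRewriting.lowerExterior R)))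
    (hψc : ContinuousOn ψ (VertexRewriting.lowerExterior R))
    (hψd : DifferentiableOn ℂ ψ (interior (VertexRewriting.lowerExterior R)))
    (hψO : ψ =O[Bornology.cobounded ℂ ⊓ 𝓟 (VertexRewriting.closedSectors R)]
      fun z : ℂ => (z ^ 4)⁻¹)
    (hφ0 : Tendsto φ (Bornology.cobounded ℂ ⊓ 𝓟 (VertexRewriting.closedSectors R)) (𝓝 0))
    (k : ℕ) (hk : k ≤ 2) (t : ℝ) (ht : 0 < t) :
    ContDiffOn ℝ k
      (fun x : ℝ => VertexRewriting.gammaPlusIntegral R fun z =>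
        Complex.exp (Complex.I * VertexRewriting.nu a z * x - Complex.I * z ^ 3 * t) * θ z)
      (Set.Ioi 0) ∧
    ∃ L : ℂ,
      Tendsto
        (fun x : ℝ => (-Complex.I) ^ k *
          iteratedDeriv k
            (fun x : ℝ => VertexRewriting.gammaPlusIntegral R fun z =>
              Complex.exp (Complex.I * VertexRewriting.nu a z * x - Complex.I * z ^ 3 * t) * θ z)
            x)
        (𝓝[>] 0) (𝓝 L) ∧
      Tendsto
        (fun C : ℝ =>
          VertexRewriting.boundaryDIntegral R C
              (fun z => Complex.exp (-Complex.I * z ^ 3 * t) * ψ z * VertexRewriting.nu a z ^ k)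
            + VertexRewriting.gammaIntegral R ε C
              (fun z => Complex.exp (-Complex.I * z ^ 3 * t) * φ z * VertexRewriting.nu a z ^ k))
        atTop (𝓝 L) := by
  open VertexRewriting in
  have hsub := cubicSectors_subset_closedSectors hR
  have hlow := cubicSectors_subset_lowerExterior R
  have hle : Bornology.cobounded ℂ ⊓ 𝓟 (cubicSectors R) ≤
      Bornology.cobounded ℂ ⊓ 𝓟 (closedSectors R) := inf_le_inf_left _ (principal_mono.2 hsub)
  obtain ⟨M, -, hM⟩ := exists_norm_nu_sub_le hR haR
  have hθc : ContinuousOn θ (lowerExterior R) := (hφc.add hψc).congr hθ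
  have hθd : DifferentiableOn ℂ θ (interior (lowerExterior R)) :=
    (hφd.add hψd).congr fun z hz => hθ z (interior_subset hz)
  have hψO' := hψO.mono hle
  have hθ0 : Tendsto θ (Bornology.cobounded ℂ ⊓ 𝓟 (cubicSectors R)) (𝓝 0) := by
    have h := (hφ0.mono_left hle).add (tendsto_zero_of_isBigO four_ne_zero inf_le_left hψO')
    rw [add_zero] at h
    refine h.congr' ?_
    rw [EventuallyEq, eventually_inf_principal]
    exact Eventually.of_forall fun z hz => (hθ z (hlow hz)).symm
  obtain ⟨B, -, hθB⟩ := exists_norm_le_of_tendsto (isClosed_cubicSectors R) (hθc.mono hlow) hθ0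
  -- Valid for every real `x`, so `x = 0` is an ordinary point and the one-sided limit is a value.
  have hder := hasDerivAt_gammaIntegralInfty hR haR hε hεR ht hM hθc hθB
  have hI : (fun x : ℝ => gammaPlusIntegral R fun z =>
      Complex.exp (Complex.I * nu a z * x - Complex.I * z ^ 3 * t) * θ z) =
      fun x => gammaIntegralInfty R ε (kernel a t θ 0 x) := by
    funext x
    rw [← gammaPlusIntegral_kernel hR haR hε hεR ht hM hθ₁ hθc hθd hθB x]
    refine congrArg (gammaPlusIntegral R) (funext fun z => ?_)
    rw [kernel, pow_zero, mul_one]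
  rw [hI]
  refine ⟨(contDiff_of_hasDerivAt
    (F := fun j x => gammaIntegralInfty R ε (kernel a t θ j x)) hder k).contDiffOn,
    (-Complex.I) ^ k * gammaIntegralInfty R ε (kernel a t θ k 0), ?_, ?_⟩
  · rw [iteratedDeriv_of_hasDerivAt
      (F := fun j x => gammaIntegralInfty R ε (kernel a t θ j x)) hder k]
    exact ((hder k 0).continuousAt.tendsto.mono_left nhdsWithin_le_nhds).const_mul _
  · have h1 := (tendsto_gammaIntegral hR haR hε hεR ht hM (hθc.mono hlow) hθB k 0).const_mul
      ((-Complex.I) ^ k)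
    have cont : ∀ {f : ℂ → ℂ}, ContinuousOn f (lowerExterior R) → ContinuousOn
        (fun z => Complex.exp (-Complex.I * z ^ 3 * t) * f z * nu a z ^ k) (lowerExterior R) :=
      fun hf => by
        simp only [← neg_I_pow_mul_kernel]
        exact continuousOn_const.mul (continuousOn_kernel hR haR hf k 0)
    -- Only the `ψ` part is moved to `∂D`; `φ` merely tends to zero, without a rate, and stays on
    -- `Γ`.
    have h2 := tendsto_boundaryDIntegral_sub (R := R) (ε := ε)
      (f := fun z => Complex.exp (-Complex.I * z ^ 3 * t) * ψ z * nu a z ^ k) hR hε hεR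
      ((cont hψc).mono hlow)
      (fun z hz => by
        simp only [← neg_I_pow_mul_kernel]
        exact (differentiableAt_kernel hR haR hψd k 0 hz).const_mul _)
      (tendsto_mul_exp_mul_nu_pow hk ht.le hψO')
    have h3 := h2.add h1
    rw [zero_add] at h3
    refine h3.congr' ?_
    filter_upwards [eventually_ge_atTop R] with C hC
    rw [← gammaIntegral_const_mul]
    simp only [neg_I_pow_mul_kernel]
    have h4 := gammaIntegral_add hR hC hε hεR
      (h := fun z => Complex.exp (-Complex.I * z ^ 3 * t) * θ z * nu a z ^ k)
      (cont hφc) (cont hψc) fun z hz => by rw [hθ z hz]; ring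
    rw [h4]
    ring
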